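/- Work in $\mathbb R^3$ with coordinates $(x,y,z)$ and the contact form $\alpha=dz-y\,dx$. A link is a finite (possibly empty) disjoint union of smoothly embedded oriented closed curves in $\mathbb R^3$; a knot is a link with one component; a link is Legendrian if $\alpha$ vanishes on its tangent vectors. **Cobordisms.** A (smooth, oriented) cobordism from a link $K_0$ to a link $K_1$ is a properly embedded oriented smooth surface $W\subset\mathbb R\times\mathbb R^3$ for which there are $T_0<T_1$ such that $W\cap([T_0,T_1]\times\mathbb R^3)$ is compact, $W\cap((-\infty,T_0]\times\mathbb R^3)=(-\infty,T_0]\times K_0$ and $W\cap([T_1,\infty)\times\mathbb R^3)=[T_1,\infty)\times K_1$, the cylinders being oriented as products. Its Euler characteristic is that of its compact part $W\cap([T_0,T_1]\times\mathbb R^3)$. A Lagrangian cobordism between Legendrian links is a cobordism $L$ on which $d(e^t\alpha)$ vanishes and $e^t\alpha|_L$ has a primitive that is constant on each of the two cylindrical ends. **Genus.** The genus $g$ of a compact oriented surface with $c$ connected components, $b$ boundary circles and Euler characteristic $\chi$ is determined by $\chi=2c-2g-b$ (for a connected surface, $\chi=2-2g-b$; in general $g$ is the sum of the genera of the components). The genus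 of a cobordism is that of its compact part. For knots $K,K'$, the smooth cobordism genus $g_s(K,K')$ is the minimum genus of all cobordisms from $K$ to $K'$. **Quasi-cobordisms.** A Lagrangian quasi-cobordism between Legendrian links $\Lambda$ and $\Lambda'$ consists of Legendrian links $\Lambda=\Lambda_0,\Lambda_1,\dots,\Lambda_n=\Lambda'$ ($n\ge1$), nonempty Legendrian links $\Lambda_1^*,\dots,\Lambda_n^*$, and Lagrangian cobordisms $L_1^<,L_1^>,\dots,L_n^<,L_n^>$ such that, for each $i$, either $L_i^<$ goes from $\Lambda_{i-1}$ to $\Lambda_i^*$ and $L_i^>$ from $\Lambda_i$ to $\Lambda_i^*$ (an upper bound), or $L_i^<$ goes from $\Lambda_i^*$ to $\Lambda_{i-1}$ and $L_i^>$ from $\Lambda_i^*$ to $\Lambda_i$ (a lower bound). Its Euler characteristic is $\chi=\sum_i\bigl(\chi(L_i^<)+\chi(L_i^>)\bigr)$. Its composite surface is obtained by stacking the compact parts of $L_1^<,L_1^>,\dots,L_n^<,L_n^>$ in this order (with cylindrical collars), after reversing the $t$-direction of $L_i^>$ at an upper bound and of $L_i^<$ at a lower bound. Its genus $g$ is determined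 by $\chi=2c-2g-b$, where $c$ is the number of connected components of the composite surface and $b$ is the total number of components of $\Lambda$ and $\Lambda'$. The relative Lagrangian genus $g_L(\Lambda,\Lambda')$ is the minimum genus of all Lagrangian quasi-cobordisms between $\Lambda$ and $\Lambda'$ ($+\infty$ if there is none). **Statement.** For all Legendrian knots $\Lambda$ and $\Lambda'$, $$g_s(\Lambda,\Lambda')\le g_L(\Lambda,\Lambda').$$ The same inequality holds for the connected versions: if $g_s^{c}$ is the minimum genus over connected cobordisms only, and $g_L^{c}$ the minimum genus over those Lagrangian quasi-cobordisms whose composite surface is connected, then $g_s^{c}(\Lambda,\Lambda')\le g_L^{c}(\Lambda,\Lambda')$. -/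

import Mathlib

open scoped ContDiff

namespace LegCob

/-- The space `ℝ³` with coordinates `(x, y, z) = (p 0, p 1, p 2)`. -/
abbrev Space3 : Type := Fin 3 → ℝ

/-- The product `ℝ × ℝ³` with coordinates `(t, p)`. -/
abbrev Space4 : Type := ℝ × Space3

/-- The standard contact form `α = dz - y dx` on `ℝ³`. -/
noncomputable def contactForm (p : Space3) : Space3 →L[ℝ] ℝ :=
  ContinuousLinearMap.proj (R := ℝ) (φ := fun _ : Fin 3 => ℝ) 2
    - p 1 • ContinuousLinearMap.proj (R := ℝ) (φ := fun _ : Fin 3 => ℝ) 0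

/-- The one-form `e^t α` on `ℝ × ℝ³`. -/
noncomputable def liouvilleForm (q : Space4) : Space4 →L[ℝ] ℝ :=
  Real.exp q.1 • (contactForm q.2).comp (ContinuousLinearMap.snd ℝ ℝ Space3)

/-- The symplectic form `d(e^t α)` of the symplectization, written with the formula
`dλ_q(u, v) = (D_u λ)_q(v) - (D_v λ)_q(u)` for the exterior derivative of a one-form. -/
noncomputable def symplecticForm (q u v : Space4) : ℝ :=
  fderiv ℝ liouvilleForm q u v - fderiv ℝ liouvilleForm q v u

/-- An oriented smooth link in `ℝ³` (possibly empty): finitely many disjoint embedded closed curves,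
given by regular `1`-periodic parametrizations, which also carry the orientation. -/
structure OrientedLink where
  numComponents : ℕ
  curve : Fin numComponents → ℝ → Space3
  smooth : ∀ i, ContDiff ℝ ∞ (curve i)
  periodic : ∀ i, Function.Periodic (curve i) 1
  regular : ∀ i s, deriv (curve i) s ≠ 0
  injective : ∀ i j s t, curve i s = curve j t → i = j ∧ ∃ k : ℤ, s = t + k

namespace OrientedLink

/-- The underlying point set of a link. -/
def range (K : OrientedLink) : Set Space3 := ⋃ i, Set.range (K.curve i)

/-- A knot is a link with exactly one component. -/
def IsKnot (K : OrientedLink) : Prop := K.numComponents = 1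

/-- A link is Legendrian if it is everywhere tangent to the contact planes `ker α`. -/
def IsLegendrian (K : OrientedLink) : Prop :=
  ∀ i s, contactForm (K.curve i s) (deriv (K.curve i) s) = 0

end OrientedLink

/-- `S ⊆ ℝ × ℝ³` is a smooth embedded surface without boundary: around each of its points there is a
smooth chart of the ambient space that flattens `S` onto the plane of vanishing second component. -/
def IsSmoothSurface (S : Set Space4) : Prop :=
  ∀ p ∈ S, ∃ Φ : OpenPartialHomeomorph Space4 ((ℝ × ℝ) × (ℝ × ℝ)),
    p ∈ Φ.source ∧ ContDiffOn ℝ ∞ Φ Φ.source ∧ ContDiffOn ℝ ∞ Φ.symm Φ.target ∧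
      ∀ q ∈ Φ.source, q ∈ S ↔ (Φ q).2 = 0

/-- `Ω` orients the surface `S`: it is a continuous field of alternating bilinear forms along `S`
that restricts to an area form on each tangent plane. (The tangent plane of a smooth surface at `p`
is its tangent cone `tangentConeAt ℝ S p`.) A tangent basis `(u, v)` is positive if
`Ω p u v > 0`. -/
structure IsOrientationForm (S : Set Space4) (Ω : Space4 → Space4 →L[ℝ] Space4 →L[ℝ] ℝ) : Prop where
  continuousOn : ContinuousOn Ω S
  alternating : ∀ p ∈ S, ∀ u, Ω p u u = 0
  nonvanishing : ∀ p ∈ S, ∀ u ∈ tangentConeAt ℝ S p, ∀ v ∈ tangentConeAt ℝ S p,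
    LinearIndependent ℝ ![u, v] → Ω p u v ≠ 0

/-- A smooth oriented cobordism from `K₀` to `K₁`: a properly embedded oriented smooth surface in
`ℝ × ℝ³` that is compact over `[T₀, T₁]` and agrees, as an oriented surface, with the cylinders
`ℝ × K₀` for `t ≤ T₀` and `ℝ × K₁` for `t ≥ T₁`. Both cylinders carry the product orientation, so
that the oriented boundary of the compact part is `K₁ - K₀`. -/
structure Cobordism (K₀ K₁ : OrientedLink) where
  carrier : Set Space4
  T₀ : ℝ
  T₁ : ℝ
  T₀_lt_T₁ : T₀ < T₁
  isSmoothSurface : IsSmoothSurface carrier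
  isCompact : IsCompact (carrier ∩ {q | T₀ ≤ q.1 ∧ q.1 ≤ T₁})
  lower_end : carrier ∩ {q | q.1 ≤ T₀} = Set.Iic T₀ ×ˢ K₀.range
  upper_end : carrier ∩ {q | T₁ ≤ q.1} = Set.Ici T₁ ×ˢ K₁.range
  orientable : ∃ Ω, IsOrientationForm carrier Ω ∧
    (∀ t ≤ T₀, ∀ i s, 0 < Ω (t, K₀.curve i s) (1, 0) (0, deriv (K₀.curve i) s)) ∧
    (∀ t, T₁ ≤ t → ∀ i s, 0 < Ω (t, K₁.curve i s) (1, 0) (0, deriv (K₁.curve i) s))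

/-- An exact oriented Lagrangian cobordism from `Λ₀` to `Λ₁` in the symplectization
`(ℝ × ℝ³, d(e^t α))`: the ends are Legendrian, the symplectic form vanishes on tangent vectors, and
`e^t α` has a smooth primitive on the surface that is constant (not merely locally constant) on each
of the two cylindrical ends. (The surface is closed in `ℝ × ℝ³`, so smooth functions on it are
the restrictions of smooth functions on `ℝ × ℝ³`.) -/
structure LagrangianCobordism (Λ₀ Λ₁ : OrientedLink) extends Cobordism Λ₀ Λ₁ where
  legendrian_lower : Λ₀.IsLegendrian
  legendrian_upper : Λ₁.IsLegendrian
  isLagrangian : ∀ q ∈ carrier, ∀ u ∈ tangentConeAt ℝ carrier q, ∀ v ∈ tangentConeAt ℝ carrier q,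
    symplecticForm q u v = 0
  isExact : ∃ f : Space4 → ℝ, ContDiff ℝ ∞ f ∧
    (∀ q ∈ carrier, ∀ u ∈ tangentConeAt ℝ carrier q, fderiv ℝ f q u = liouvilleForm q u) ∧
    (∃ c, ∀ q ∈ carrier, q.1 ≤ T₀ → f q = c) ∧
    (∃ c, ∀ q ∈ carrier, T₁ ≤ q.1 → f q = c)

/-- The compact surface `A` with boundary `B` has Euler characteristic `χ`: for a finite cell
decomposition of `A` into cells of dimension at most two in which `B` is a union of vertices and
edges, the number of vertices minus the number of edges plus the number of faces is `χ`. -/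
def HasEulerCharacteristic (A B : Set Space4) (χ : ℤ) : Prop :=
  ∃ _ : Topology.CWComplex A,
    (∀ n, Finite (Topology.RelCWComplex.cell A n)) ∧
    (∀ n, 2 < n → IsEmpty (Topology.RelCWComplex.cell A n)) ∧
    (∃ (I₀ : Set (Topology.RelCWComplex.cell A 0)) (I₁ : Set (Topology.RelCWComplex.cell A 1)),
      B = (⋃ i ∈ I₀, Topology.RelCWComplex.openCell 0 i) ∪
        (⋃ i ∈ I₁, Topology.RelCWComplex.openCell 1 i)) ∧
    χ = (Nat.card (Topology.RelCWComplex.cell A 0) : ℤ)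
      - Nat.card (Topology.RelCWComplex.cell A 1) + Nat.card (Topology.RelCWComplex.cell A 2)

/-- The number of connected components of a set. -/
noncomputable def numConnectedComponents (A : Set Space4) : ℕ := Nat.card (ConnectedComponents A)

/-- The relation between the genus `g` and the Euler characteristic `χ` of a compact oriented surface
with `c` connected components and `b` boundary circles: `χ = 2c - 2g - b`. For a connected surface
this is the usual `χ = 2 - 2g - b`; in general `g` is the sum of the genera of the components. -/
def GenusRelation (c b : ℕ) (χ : ℤ) (g : ℕ) : Prop := χ = 2 * (c : ℤ) - 2 * (g : ℤ) - (b : ℤ)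

namespace Cobordism

variable {K₀ K₁ : OrientedLink}

/-- The part of a cobordism between its two cylindrical ends, a compact surface with boundary. -/
def compactPart (W : Cobordism K₀ K₁) : Set Space4 :=
  W.carrier ∩ {q | W.T₀ ≤ q.1 ∧ q.1 ≤ W.T₁}

/-- The boundary of the compact part. -/
def boundary (W : Cobordism K₀ K₁) : Set Space4 :=
  ({W.T₀} ×ˢ K₀.range) ∪ ({W.T₁} ×ˢ K₁.range)

/-- The Euler characteristic of a cobordism is that of its compact part. -/
def HasEulerChar (W : Cobordism K₀ K₁) (χ : ℤ) : Prop :=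
  HasEulerCharacteristic W.compactPart W.boundary χ

/-- The cobordism `W` has genus `g`. -/
def HasGenus (W : Cobordism K₀ K₁) (g : ℕ) : Prop :=
  ∃ χ : ℤ, W.HasEulerChar χ ∧
    GenusRelation (numConnectedComponents W.compactPart) (K₀.numComponents + K₁.numComponents) χ g

/-- The part of `W` over `[T₀ - 1, T₁ + 1]` (the compact part with a cylindrical collar at each
end), moved to the slab `[k, k + 1] × ℝ³` by an increasing affine change of `t`. -/
def stacked (W : Cobordism K₀ K₁) (k : ℕ) : Set Space4 :=
  {q | (k : ℝ) ≤ q.1 ∧ q.1 ≤ k + 1 ∧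
    (W.T₀ - 1 + (q.1 - k) * (W.T₁ - W.T₀ + 2), q.2) ∈ W.carrier}

/-- As `stacked`, with the direction of `t` reversed. -/
def stackedReversed (W : Cobordism K₀ K₁) (k : ℕ) : Set Space4 :=
  {q | (k : ℝ) ≤ q.1 ∧ q.1 ≤ k + 1 ∧
    (W.T₁ + 1 - (q.1 - k) * (W.T₁ - W.T₀ + 2), q.2) ∈ W.carrier}

end Cobordism

/-- The smooth cobordism genus: the minimal genus of all smooth oriented cobordisms
from `K` to `K'`. -/
noncomputable def smoothCobordismGenus (K K' : OrientedLink) : ℕ∞ :=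
  ⨅ (W : Cobordism K K') (g : ℕ) (_ : W.HasGenus g), (g : ℕ∞)

/-- The minimal genus of the connected smooth oriented cobordisms from `K` to `K'`. -/
noncomputable def connectedSmoothCobordismGenus (K K' : OrientedLink) : ℕ∞ :=
  ⨅ (W : Cobordism K K') (g : ℕ) (_ : IsConnected W.compactPart ∧ W.HasGenus g), (g : ℕ∞)

/-- An upper or lower bound for the pair `(Λ, Λ')` with respect to Lagrangian cobordism: a nonempty
link `M` (Legendrian, being an end of Lagrangian cobordisms), together with two Lagrangian
cobordisms `left`, `right` that realize the bound. -/
inductive LagrangianBound (Λ Λ' : OrientedLink) where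
  | upper (M : OrientedLink) (nonempty : 0 < M.numComponents)
      (left : LagrangianCobordism Λ M) (right : LagrangianCobordism Λ' M)
  | lower (M : OrientedLink) (nonempty : 0 < M.numComponents)
      (left : LagrangianCobordism M Λ) (right : LagrangianCobordism M Λ')

namespace LagrangianBound

variable {Λ Λ' : OrientedLink}

/-- The sum of the Euler characteristics of the two Lagrangians of the bound is `χ`. -/
def HasEulerChar : LagrangianBound Λ Λ' → ℤ → Prop
  | upper _ _ left right, χ =>
      ∃ χ₁ χ₂ : ℤ, left.HasEulerChar χ₁ ∧ right.HasEulerChar χ₂ ∧ χ = χ₁ + χ₂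
  | lower _ _ left right, χ =>
      ∃ χ₁ χ₂ : ℤ, left.HasEulerChar χ₁ ∧ right.HasEulerChar χ₂ ∧ χ = χ₁ + χ₂

/-- The smooth composition of the two Lagrangians, placed in `[2k, 2k + 2] × ℝ³` and running from
`Λ` at the bottom to `Λ'` at the top: the right one of an upper bound and the left one of a lower
bound are reversed. -/
def composite : LagrangianBound Λ Λ' → ℕ → Set Space4
  | upper _ _ left right, k => left.stacked (2 * k) ∪ right.stackedReversed (2 * k + 1)
  | lower _ _ left right, k => left.stackedReversed (2 * k) ∪ right.stacked (2 * k + 1)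

end LagrangianBound

/-- A Lagrangian quasi-cobordism between `Λ` and `Λ'`: links `Λ = Λ_0, …, Λ_n = Λ'`, with `n ≥ 1`,
and an upper or lower bound, realized by Lagrangian cobordisms, for each pair of consecutive links.
(All links that occur are Legendrian, being ends of Lagrangian cobordisms.) -/
structure LagrangianQuasiCobordism (Λ Λ' : OrientedLink) where
  length : ℕ
  length_pos : 0 < length
  link : Fin (length + 1) → OrientedLink
  link_first : link 0 = Λ
  link_last : link (Fin.last length) = Λ'
  bound : ∀ i : Fin length, LagrangianBound (link i.castSucc) (link i.succ)

namespace LagrangianQuasiCobordism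

variable {Λ Λ' : OrientedLink}

/-- The Euler characteristic of a quasi-cobordism: the sum of the Euler characteristics of all its
Lagrangians. -/
def HasEulerChar (Q : LagrangianQuasiCobordism Λ Λ') (χ : ℤ) : Prop :=
  ∃ e : Fin Q.length → ℤ, (∀ i, (Q.bound i).HasEulerChar (e i)) ∧ χ = ∑ i, e i

/-- The surface composed of all Lagrangians of the quasi-cobordism, running from `Λ` to `Λ'`. -/
def composite (Q : LagrangianQuasiCobordism Λ Λ') : Set Space4 :=
  ⋃ i : Fin Q.length, (Q.bound i).composite i

/-- The quasi-cobordism `Q` has genus `g`; the genus is determined by the Euler characteristic of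
`Q`, together with the numbers of components and of boundary circles of the composite surface. -/
def HasGenus (Q : LagrangianQuasiCobordism Λ Λ') (g : ℕ) : Prop :=
  ∃ χ : ℤ, Q.HasEulerChar χ ∧
    GenusRelation (numConnectedComponents Q.composite) (Λ.numComponents + Λ'.numComponents) χ g

end LagrangianQuasiCobordism

/-- The relative Lagrangian genus: the minimal genus of all Lagrangian quasi-cobordisms between `Λ`
and `Λ'` (`⊤` if there is none). -/
noncomputable def relativeLagrangianGenus (Λ Λ' : OrientedLink) : ℕ∞ :=
  ⨅ (Q : LagrangianQuasiCobordism Λ Λ') (g : ℕ) (_ : Q.HasGenus g), (g : ℕ∞)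

/-- The minimal genus of the Lagrangian quasi-cobordisms between `Λ` and `Λ'` whose composite
surface is connected (`⊤` if there is none). -/
noncomputable def connectedRelativeLagrangianGenus (Λ Λ' : OrientedLink) : ℕ∞ :=
  ⨅ (Q : LagrangianQuasiCobordism Λ Λ') (g : ℕ) (_ : IsConnected Q.composite ∧ Q.HasGenus g),
    (g : ℕ∞)

end LegCob

/-!
Moving the lower and upper bounds of a quasi-cobordism in the `t`-direction by affine maps,
reversing those that are traversed backwards, and gluing them along their cylindrical ends yields
one smooth cobordism whose compact part is the composite surface. On the overlap of two consecutive
pieces, a product cylinder, their orientation forms agree up to a positive factor on the tangent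
planes, so a cutoff function interpolates between them. Euler characteristics add up: the cells at
the two ends of a cylinder can be joined by one arc along each component, and a component then
contributes one arc and one face, which cancel. Hence the cobordism and the quasi-cobordism have
the same Euler characteristic, the same components and the same boundary circles, and therefore the
same genus.
-/

namespace LegCob

open Function Set Metric Topology AffineMap

section Cells

variable {X Y : Type*} [TopologicalSpace X] [TopologicalSpace Y]

/-- `e` is an open `n`-cell of a cell complex, attached along the boundary of the unit ball (of the
sup norm) to the subset `S`. The attaching map need not be injective on the sphere. -/
def IsCell (S : Set X) (n : ℕ) (e : Set X) : Prop :=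
  ∃ φ : (Fin n → ℝ) → X, ContinuousOn φ (closedBall 0 1) ∧ InjOn φ (ball 0 1) ∧
    φ '' ball 0 1 = e ∧ MapsTo φ (sphere 0 1) S

namespace IsCell

variable {S T e : Set X} {n : ℕ}

theorem mono (h : IsCell S n e) (hST : S ⊆ T) : IsCell T n e :=
  let ⟨φ, hcont, hinj, himg, hmaps⟩ := h
  ⟨φ, hcont, hinj, himg, hmaps.mono_right hST⟩

theorem image (h : IsCell S n e) {f : X → Y} (hf : Continuous f) (hi : Injective f) :
    IsCell (f '' S) n (f '' e) := by
  obtain ⟨φ, hcont, hinj, rfl, hmaps⟩ := h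
  exact ⟨f ∘ φ, hf.comp_continuousOn hcont, hi.comp_injOn hinj, image_comp f φ _,
    (mapsTo_image f S).comp hmaps⟩

theorem nonempty (h : IsCell S n e) : e.Nonempty := by
  obtain ⟨φ, -, -, rfl, -⟩ := h
  exact (nonempty_ball.2 one_pos).image φ

theorem isPreconnected (h : IsCell S n e) : IsPreconnected e := by
  obtain ⟨φ, hcont, -, rfl, -⟩ := h
  exact (convex_ball _ _).isPreconnected.image _ (hcont.mono ball_subset_closedBall)

theorem exists_eq_singleton (h : IsCell S 0 e) : ∃ x, e = {x} := by
  obtain ⟨φ, -, -, rfl, -⟩ := h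
  have hball : ball (0 : Fin 0 → ℝ) 1 = {0} := eq_singleton_iff_unique_mem.2
    ⟨mem_ball_self one_pos, fun _ _ => Subsingleton.elim _ _⟩
  exact ⟨φ 0, by rw [hball, image_singleton]⟩

theorem exists_mem_closure (h : IsCell S 1 e) : ∃ x ∈ S, x ∈ closure e := by
  obtain ⟨φ, hcont, -, rfl, hmaps⟩ := h
  have hone : (1 : Fin 1 → ℝ) ∈ sphere (0 : Fin 1 → ℝ) 1 := by simp
  have hclosure : closure (ball (0 : Fin 1 → ℝ) 1) = closedBall 0 1 := closure_ball _ one_ne_zero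
  exact ⟨φ 1, hmaps hone, (hclosure ▸ hcont).image_closure
    ⟨1, hclosure ▸ sphere_subset_closedBall hone, rfl⟩⟩

theorem of_cube {f : (Fin n → ℝ) → X} (hf : ContinuousOn f (univ.pi fun _ => Icc 0 1))
    (hinj : InjOn f (univ.pi fun _ => Ioo 0 1))
    (hmaps : MapsTo f ((univ.pi fun _ => Icc 0 1) \ univ.pi fun _ => Ioo 0 1) S) :
    IsCell S n (f '' univ.pi fun _ => Ioo 0 1) := by
  let h : (Fin n → ℝ) ≃ (Fin n → ℝ) :=
    { toFun := fun x i => (x i + 1) / 2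
      invFun := fun x i => 2 * x i - 1
      left_inv := fun x => funext fun i => by ring
      right_inv := fun x => funext fun i => by ring }
  have hball : h ⁻¹' (univ.pi fun _ => Ioo (0 : ℝ) 1) = ball 0 1 := by
    ext x
    simp only [mem_preimage, mem_univ_pi, mem_ball, dist_pi_lt_iff one_pos, Pi.zero_apply,
      Real.dist_0_eq_abs, abs_lt]
    refine forall_congr' fun i => ?_
    simp only [h, Equiv.coe_fn_mk, mem_Ioo]
    constructor <;> rintro ⟨_, _⟩ <;> constructor <;> linarith
  have hclosedBall : h ⁻¹' (univ.pi fun _ => Icc (0 : ℝ) 1) = closedBall 0 1 := by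
    ext x
    simp only [mem_preimage, mem_univ_pi, mem_closedBall, dist_pi_le_iff zero_le_one,
      Pi.zero_apply, Real.dist_0_eq_abs, abs_le]
    refine forall_congr' fun i => ?_
    simp only [h, Equiv.coe_fn_mk, mem_Icc]
    constructor <;> rintro ⟨_, _⟩ <;> constructor <;> linarith
  have hcont : Continuous h := continuous_pi fun i => by simp only [h, Equiv.coe_fn_mk]; fun_prop
  refine ⟨f ∘ h, ?_, ?_, ?_, ?_⟩
  · exact hclosedBall ▸ hf.comp hcont.continuousOn (mapsTo_preimage _ _)
  · exact hball ▸ hinj.comp h.injective.injOn (mapsTo_preimage _ _)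
  · rw [image_comp, ← hball, image_preimage_eq _ h.surjective]
  · rw [← closedBall_sdiff_ball, ← hclosedBall, ← hball, ← preimage_sdiff]
    exact hmaps.comp (mapsTo_preimage _ _)

theorem of_singleton (S : Set X) (x : X) : IsCell S 0 {x} := by
  have hcube : (univ.pi fun _ => Ioo 0 1 : Set (Fin 0 → ℝ)) = univ :=
    eq_univ_of_forall fun x i => i.elim0
  have h := of_cube (S := S) (f := fun _ : Fin 0 → ℝ => x) continuousOn_const
    (injOn_of_subsingleton _ _) (fun y hy => absurd (fun i => i.elim0) hy.2)
  rwa [hcube, image_univ, range_const] at h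

theorem of_interval {γ : ℝ → X} (hγ : ContinuousOn γ (Icc 0 1)) (hinj : InjOn γ (Ioo 0 1))
    (h₀ : γ 0 ∈ S) (h₁ : γ 1 ∈ S) : IsCell S 1 (γ '' Ioo 0 1) := by
  let h := Homeomorph.funUnique (Fin 1) ℝ
  have hIoo : h ⁻¹' Ioo 0 1 = univ.pi fun _ => Ioo 0 1 := by
    ext x; simp [h]
  have hIcc : h ⁻¹' Icc 0 1 = univ.pi fun _ => Icc 0 1 := by
    ext x; simp [h, -pi_univ_Icc]
  have hcell := of_cube (S := S) (f := γ ∘ h)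
    (hIcc ▸ hγ.comp h.continuous.continuousOn (mapsTo_preimage _ _))
    (hIoo ▸ hinj.comp h.injective.injOn (mapsTo_preimage _ _)) (by
      rw [← hIoo, ← hIcc, ← preimage_sdiff, Icc_sdiff_Ioo_same zero_le_one]
      rintro x (hx | hx)
      · rwa [comp_apply, hx]
      · rwa [comp_apply, mem_singleton_iff.1 hx])
  rwa [← hIoo, image_comp, image_preimage_eq _ h.surjective] at hcell

theorem of_square {f : ℝ × ℝ → X} (hf : ContinuousOn f (Icc 0 1 ×ˢ Icc 0 1))
    (hinj : InjOn f (Ioo 0 1 ×ˢ Ioo 0 1))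
    (hmaps : MapsTo f ((Icc 0 1 ×ˢ Icc 0 1) \ Ioo 0 1 ×ˢ Ioo 0 1) S) :
    IsCell S 2 (f '' Ioo 0 1 ×ˢ Ioo 0 1) := by
  let h := Homeomorph.finTwoArrow (X := ℝ)
  have hIoo : h ⁻¹' Ioo 0 1 ×ˢ Ioo 0 1 = univ.pi fun _ => Ioo 0 1 := by
    ext x; simp [h, Fin.forall_fin_two]
  have hIcc : h ⁻¹' Icc 0 1 ×ˢ Icc 0 1 = univ.pi fun _ => Icc 0 1 := by
    ext x; simp [h, Fin.forall_fin_two, -Icc_prod_Icc, -pi_univ_Icc]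
  have hcell := of_cube (S := S) (f := f ∘ h)
    (hIcc ▸ hf.comp h.continuous.continuousOn (mapsTo_preimage _ _))
    (hIoo ▸ hinj.comp h.injective.injOn (mapsTo_preimage _ _)) (by
      rw [← hIoo, ← hIcc, ← preimage_sdiff]
      exact hmaps.comp (mapsTo_preimage _ _))
  rwa [← hIoo, image_comp, image_preimage_eq _ h.surjective] at hcell

end IsCell

end Cells

section CellFamilies

variable {X Y : Type*}

/-- The union of the cells of dimension less than `n` of a family of cells; `E k` is the set of
`k`-cells of the family `E`. -/
def skeletonBelow (E : ℕ → Set (Set X)) (n : ℕ) : Set X := {x | ∃ m < n, ∃ e ∈ E m, x ∈ e}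

theorem skeletonBelow_mono {E F : ℕ → Set (Set X)} (h : E ≤ F) (n : ℕ) :
    skeletonBelow E n ⊆ skeletonBelow F n :=
  fun _ ⟨m, hm, e, he, hx⟩ => ⟨m, hm, e, h m he, hx⟩

/-- The alternating sum of the numbers of vertices, edges and faces. -/
noncomputable def cellCount (E : ℕ → Set (Set X)) : ℤ :=
  (E 0).ncard - (E 1).ncard + (E 2).ncard

theorem cellCount_image {f : X → Y} (hi : Injective f) (E : ℕ → Set (Set X)) :
    cellCount (fun n => Set.image f '' E n) = cellCount E := by
  simp only [cellCount, ncard_image_of_injective _ hi.image_injective]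

/-- The family of cells that consists of the members of `C`, all of them in dimension `d`. -/
def cellsOfDim (d : ℕ) (C : Set (Set X)) : ℕ → Set (Set X) := fun n => {e | n = d ∧ e ∈ C}

theorem cellsOfDim_self (d : ℕ) (C : Set (Set X)) : cellsOfDim d C d = C := by
  simp only [cellsOfDim, true_and, ofPred_mem_eq]

theorem cellsOfDim_of_ne {d n : ℕ} (h : n ≠ d) (C : Set (Set X)) : cellsOfDim d C n = ∅ := by
  simp only [cellsOfDim, h, false_and, ofPred_false]

theorem cellCount_cellsOfDim {ι : Type*} {d : ℕ} {c : ι → Set X} (hd : d ≤ 2)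
    (hne : ∀ i, (c i).Nonempty) (hdisj : Pairwise (Disjoint on c)) :
    cellCount (cellsOfDim d (range c)) = (-1) ^ d * (Nat.card ι : ℤ) := by
  have hinj : Injective c :=
    pairwise_ne_iff_injective.1 (hdisj.mono fun i _ h => h.ne (hne i).ne_empty)
  have hcard : (range c).ncard = Nat.card ι := ncard_range_of_injective hinj
  unfold cellCount
  interval_cases d <;> simp [cellsOfDim_self, cellsOfDim_of_ne, hcard]

/-- `B` is a union of vertices and edges of `E`. -/
def IsUnionOfCells (E : ℕ → Set (Set X)) (B : Set X) : Prop :=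
  ∀ x ∈ B, ∃ n ≤ 1, ∃ e ∈ E n, x ∈ e ∧ e ⊆ B

namespace IsUnionOfCells

variable {E F : ℕ → Set (Set X)} {A B C : Set X}

theorem mono (h : IsUnionOfCells E B) (hEF : E ≤ F) : IsUnionOfCells F B := fun x hx =>
  let ⟨n, hn, e, he, hxe⟩ := h x hx
  ⟨n, hn, e, hEF n he, hxe⟩

theorem subset_skeletonBelow (h : IsUnionOfCells E B) : B ⊆ skeletonBelow E 2 := fun x hx =>
  let ⟨n, hn, e, he, hxe, _⟩ := h x hx
  ⟨n, Nat.lt_succ_of_le hn, e, he, hxe⟩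

theorem union (hB : IsUnionOfCells E B) (hC : IsUnionOfCells E C) : IsUnionOfCells E (B ∪ C) := by
  rintro x (hx | hx)
  · obtain ⟨n, hn, e, he, hxe, hsub⟩ := hB x hx
    exact ⟨n, hn, e, he, hxe, hsub.trans subset_union_left⟩
  · obtain ⟨n, hn, e, he, hxe, hsub⟩ := hC x hx
    exact ⟨n, hn, e, he, hxe, hsub.trans subset_union_right⟩

theorem image (h : IsUnionOfCells E B) (f : X → Y) :
    IsUnionOfCells (fun n => Set.image f '' E n) (f '' B) := by
  rintro _ ⟨x, hx, rfl⟩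
  obtain ⟨n, hn, e, he, hxe, hsub⟩ := h x hx
  exact ⟨n, hn, _, ⟨e, he, rfl⟩, ⟨x, hxe, rfl⟩, image_mono hsub⟩

end IsUnionOfCells

end CellFamilies

section CellDecompositions

variable {X Y : Type*} [TopologicalSpace X] [TopologicalSpace Y]

/-- The cells of `E`, finitely many and of dimension at most two, decompose `A` relative to cells
`D` that are already there: `A` is the disjoint union of the cells of `E`, whose boundaries may
also be attached to cells of `D`. -/
structure IsRelCellDecomposition (D E : ℕ → Set (Set X)) (A : Set X) : Prop where
  finite : ∀ n, (E n).Finite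
  eq_empty : ∀ n, 2 < n → E n = ∅
  isCell : ∀ {n e}, e ∈ E n → IsCell (skeletonBelow (D ⊔ E) n) n e
  eq_of_mem : ∀ {n m e f x}, e ∈ E n → f ∈ E m → x ∈ e → x ∈ f → n = m ∧ e = f
  mem_iff : ∀ {x}, x ∈ A ↔ ∃ n, ∃ e ∈ E n, x ∈ e

/-- `E n` is the set of open `n`-cells of a finite cell decomposition of `A` of dimension at
most two. -/
abbrev IsCellDecomposition (E : ℕ → Set (Set X)) (A : Set X) : Prop := IsRelCellDecomposition ⊥ E A

namespace IsRelCellDecomposition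

variable {D D' E F : ℕ → Set (Set X)} {A B : Set X}

theorem subset (hE : IsRelCellDecomposition D E A) {n : ℕ} {e : Set X} (he : e ∈ E n) : e ⊆ A :=
  fun _ hx => hE.mem_iff.2 ⟨n, e, he, hx⟩

theorem mono (hE : IsRelCellDecomposition D E A) (h : D ≤ D') : IsRelCellDecomposition D' E A where
  finite := hE.finite
  eq_empty := hE.eq_empty
  isCell he := (hE.isCell he).mono (skeletonBelow_mono (sup_le_sup_right h E) _)
  eq_of_mem := hE.eq_of_mem
  mem_iff := hE.mem_iff

theorem sup (hE : IsRelCellDecomposition D E A) (hF : IsRelCellDecomposition (D ⊔ E) F B)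
    (hd : Disjoint A B) : IsRelCellDecomposition D (E ⊔ F) (A ∪ B) where
  finite n := (hE.finite n).union (hF.finite n)
  eq_empty n hn := union_empty_iff.2 ⟨hE.eq_empty n hn, hF.eq_empty n hn⟩
  isCell := by
    rintro n e (he | he)
    · exact (hE.isCell he).mono (skeletonBelow_mono (sup_le_sup_left le_sup_left D) n)
    · exact sup_assoc D E F ▸ hF.isCell he
  eq_of_mem := by
    rintro n m e f x (he | he) (hf | hf) hxe hxf
    · exact hE.eq_of_mem he hf hxe hxf
    · exact (disjoint_left.1 hd (hE.subset he hxe) (hF.subset hf hxf)).elim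
    · exact (disjoint_left.1 hd (hE.subset hf hxf) (hF.subset he hxe)).elim
    · exact hF.eq_of_mem he hf hxe hxf
  mem_iff := by
    intro x
    rw [mem_union, hE.mem_iff, hF.mem_iff, ← exists_or]
    exact exists_congr fun n => by simp only [Pi.sup_apply, sup_eq_union, mem_union, or_and_right,
      exists_or]

theorem cellCount_sup (hE : IsRelCellDecomposition D E A) (hF : IsRelCellDecomposition D' F B)
    (hd : Disjoint A B) : cellCount (E ⊔ F) = cellCount E + cellCount F := by
  have hcard : ∀ n, ((E ⊔ F) n).ncard = (E n).ncard + (F n).ncard := by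
    refine fun n => ncard_union_eq (disjoint_left.2 fun e he hf => ?_) (hE.finite n) (hF.finite n)
    obtain ⟨x, hx⟩ := (hE.isCell he).nonempty
    exact disjoint_left.1 hd (hE.subset he hx) (hF.subset hf hx)
  simp only [cellCount, hcard]
  push_cast
  ring

end IsRelCellDecomposition

theorem IsCellDecomposition.image {E : ℕ → Set (Set X)} {A : Set X} (hE : IsCellDecomposition E A)
    {f : X → Y} (hf : Continuous f) (hi : Injective f) :
    IsCellDecomposition (fun n => Set.image f '' E n) (f '' A) where
  finite n := (hE.finite n).image _
  eq_empty n hn := by rw [hE.eq_empty n hn, image_empty]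
  isCell := by
    rintro n _ ⟨e, he, rfl⟩
    refine ((hE.isCell he).image hf hi).mono ?_
    rintro _ ⟨x, ⟨m, hm, g, hg | hg, hx⟩, rfl⟩
    · exact hg.elim
    · exact ⟨m, hm, _, Or.inr ⟨g, hg, rfl⟩, x, hx, rfl⟩
  eq_of_mem := by
    rintro n m _ _ _ ⟨e, he, rfl⟩ ⟨g, hg, rfl⟩ ⟨x, hx, rfl⟩ hx'
    obtain ⟨rfl, rfl⟩ := hE.eq_of_mem he hg hx (hi.mem_set_image.1 hx')
    exact ⟨rfl, rfl⟩
  mem_iff := by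
    intro y
    constructor
    · rintro ⟨x, hx, rfl⟩
      obtain ⟨n, e, he, hxe⟩ := hE.mem_iff.1 hx
      exact ⟨n, _, ⟨e, he, rfl⟩, x, hxe, rfl⟩
    · rintro ⟨n, _, ⟨e, he, rfl⟩, x, hxe, rfl⟩
      exact ⟨x, hE.subset he hxe, rfl⟩

theorem isRelCellDecomposition_iUnion {ι : Type*} [Finite ι] {D : ℕ → Set (Set X)} {d : ℕ}
    {c : ι → Set X} (hd : d ≤ 2) (hc : ∀ i, IsCell (skeletonBelow D d) d (c i))
    (hdisj : Pairwise (Disjoint on c)) :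
    IsRelCellDecomposition D (cellsOfDim d (range c)) (⋃ i, c i) where
  finite n := (finite_range c).subset fun _ he => he.2
  eq_empty n hn := cellsOfDim_of_ne (by lia) _
  isCell := by
    rintro _ _ ⟨rfl, i, rfl⟩
    exact (hc i).mono (skeletonBelow_mono le_sup_left _)
  eq_of_mem := by
    rintro _ _ _ _ x ⟨rfl, i, rfl⟩ ⟨rfl, j, rfl⟩ hi hj
    obtain rfl : i = j := hdisj.eq (not_disjoint_iff.2 ⟨x, hi, hj⟩)
    exact ⟨rfl, rfl⟩
  mem_iff := by
    intro x
    simp only [cellsOfDim, mem_iUnion, mem_ofPred_eq, mem_range, and_assoc, exists_and_left,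
      exists_eq_left, exists_exists_eq_and]

namespace IsUnionOfCells

variable {E : ℕ → Set (Set X)} {A B C : Set X}

theorem of_union_left (h : IsUnionOfCells E (B ∪ C)) (hE : IsCellDecomposition E A)
    (hB : IsClosed B) (hC : IsClosed C) (hd : Disjoint B C) : IsUnionOfCells E B := by
  intro x hx
  obtain ⟨n, hn, e, he, hxe, hsub⟩ := h x (Or.inl hx)
  have heBC : e ⊆ B ∨ e ⊆ C := isPreconnected_iff_subset_of_disjoint_closed.1
    (hE.isCell he).isPreconnected B C hB hC hsub (by rw [hd.inter_eq, inter_empty])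
  exact ⟨n, hn, e, he, hxe, heBC.resolve_right fun heC => disjoint_left.1 hd hx (heC hxe)⟩

theorem exists_vertex (h : IsUnionOfCells E B) (hE : IsCellDecomposition E A) (hB : IsClosed B)
    (hne : B.Nonempty) : ∃ x ∈ B, {x} ∈ E 0 := by
  have of_mem : ∀ {x e}, x ∈ B → e ∈ E 0 → x ∈ e → ∃ x ∈ B, {x} ∈ E 0 := by
    intro x e hx he hxe
    obtain ⟨y, rfl⟩ := (hE.isCell he).exists_eq_singleton
    exact ⟨y, mem_singleton_iff.1 hxe ▸ hx, he⟩
  obtain ⟨x, hx⟩ := hne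
  obtain ⟨n, hn, e, he, hxe, hsub⟩ := h x hx
  interval_cases n
  · exact of_mem hx he hxe
  · obtain ⟨y, ⟨m, hm, f, hf | hf, hyf⟩, hye⟩ := (hE.isCell he).exists_mem_closure
    · exact hf.elim
    · obtain rfl : m = 0 := by lia
      exact of_mem (hB.closure_subset_iff.2 hsub hye) hf hyf

end IsUnionOfCells

end CellDecompositions

section CWComplexes

variable {X : Type*} [TopologicalSpace X]

/-- The open cells of a CW complex as a family of cells. -/
def openCells (A : Set X) [CWComplex A] : ℕ → Set (Set X) :=
  fun n => range fun i : RelCWComplex.cell A n => RelCWComplex.openCell n i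

theorem ncard_openCells (A : Set X) [T2Space X] [CWComplex A] (n : ℕ) :
    (openCells A n).ncard = Nat.card (RelCWComplex.cell A n) :=
  ncard_range_of_injective fun _ _ h => RelCWComplex.openCell_congr n h

theorem isCellDecomposition_openCells {A : Set X} [T2Space X] [CWComplex A]
    (hfin : ∀ n, Finite (RelCWComplex.cell A n))
    (hdim : ∀ n, 2 < n → IsEmpty (RelCWComplex.cell A n)) :
    IsCellDecomposition (openCells A) A where
  finite n := haveI := hfin n; finite_range _
  eq_empty n hn := haveI := hdim n hn; range_eq_empty _
  isCell := by
    rintro n _ ⟨i, rfl⟩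
    refine ⟨RelCWComplex.map n i, RelCWComplex.continuousOn n i,
      RelCWComplex.source_eq n i ▸ (RelCWComplex.map n i).injOn, rfl, fun x hx => ?_⟩
    obtain ⟨I, hI⟩ := CWComplex.cellFrontier_subset_finite_openCell n i
    obtain ⟨m, hm, j, -, hj⟩ := by
      simpa only [mem_iUnion, exists_prop] using hI (mem_image_of_mem _ hx)
    exact ⟨m, hm, _, Or.inr ⟨j, rfl⟩, hj⟩
  eq_of_mem := by
    rintro n m _ _ x ⟨i, rfl⟩ ⟨j, rfl⟩ hx hx'
    obtain ⟨rfl, h⟩ := Sigma.mk.inj_iff.1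
      (RelCWComplex.eq_of_not_disjoint_openCell (not_disjoint_iff.2 ⟨x, hx, hx'⟩))
    exact ⟨rfl, by rw [eq_of_heq h]⟩
  mem_iff := by
    intro x
    conv_lhs => rw [← CWComplex.iUnion_openCell_eq_complex (C := A)]
    simp only [openCells, mem_iUnion, mem_range, exists_exists_eq_and]

namespace IsCell

variable {S e : Set X} {n : ℕ} (h : IsCell S n e)

/-- An attaching map of the cell `e`, as a bijection from the open unit ball onto `e`. -/
noncomputable def charMap : PartialEquiv (Fin n → ℝ) X :=
  h.choose_spec.2.1.toPartialEquiv h.choose (ball 0 1)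

theorem continuousOn_charMap : ContinuousOn h.charMap (closedBall 0 1) := h.choose_spec.1

theorem charMap_target : h.charMap.target = e := h.choose_spec.2.2.1

theorem charMap_image_ball : h.charMap '' ball 0 1 = e := h.charMap_target

theorem mapsTo_charMap : MapsTo h.charMap (sphere 0 1) S := h.choose_spec.2.2.2

theorem subset_charMap_image_closedBall : e ⊆ h.charMap '' closedBall 0 1 :=
  h.charMap_image_ball.symm.trans_subset (image_mono ball_subset_closedBall)

theorem charMap_image_closedBall_subset : h.charMap '' closedBall 0 1 ⊆ S ∪ e := by
  rw [← sphere_union_ball, image_union, h.charMap_image_ball]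
  exact union_subset_union_left e h.mapsTo_charMap.image_subset

/-- On `e`, the preimage of a closed set under the inverse of the attaching map is the trace of the
image, which is compact, of a closed subset of the closed ball. -/
theorem continuousOn_charMap_symm [T2Space X] (hd : Disjoint S e) :
    ContinuousOn h.charMap.symm h.charMap.target := by
  rw [h.charMap_target, continuousOn_iff_isClosed]
  intro Z hZ
  refine ⟨h.charMap '' (closedBall 0 1 ∩ Z), (((isCompact_closedBall (0 : Fin n → ℝ) 1).inter_right
    hZ).image_of_continuousOn (h.continuousOn_charMap.mono inter_subset_left)).isClosed, ?_⟩
  have hsource : ∀ {x}, x ∈ closedBall (0 : Fin n → ℝ) 1 → h.charMap x ∈ e →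
      x ∈ ball (0 : Fin n → ℝ) 1 := by
    intro x hx hxe
    by_contra hball
    have hsphere : x ∈ sphere (0 : Fin n → ℝ) 1 := by
      rw [← closedBall_sdiff_ball]
      exact ⟨hx, hball⟩
    exact disjoint_left.1 hd (h.mapsTo_charMap hsphere) hxe
  ext y
  constructor
  · rintro ⟨hyZ, hye⟩
    obtain ⟨x, hx, rfl⟩ := h.subset_charMap_image_closedBall hye
    rw [mem_preimage, h.charMap.left_inv (hsource hx hye)] at hyZ
    exact ⟨⟨x, ⟨hx, hyZ⟩, rfl⟩, hye⟩
  · rintro ⟨⟨x, ⟨hx, hxZ⟩, rfl⟩, hye⟩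
    rw [mem_inter_iff, mem_preimage, h.charMap.left_inv (hsource hx hye)]
    exact ⟨hxZ, hye⟩

end IsCell

namespace IsCellDecomposition

variable {E : ℕ → Set (Set X)} {A : Set X}

theorem disjoint_skeletonBelow (hE : IsCellDecomposition E A) {n : ℕ} {e : Set X} (he : e ∈ E n) :
    Disjoint (skeletonBelow (⊥ ⊔ E) n) e := by
  rw [disjoint_left, bot_sup_eq]
  rintro x ⟨m, hm, f, hf, hxf⟩ hxe
  exact hm.ne (hE.eq_of_mem hf he hxf hxe).1

/-- The CW complex given by a finite cell decomposition of a subset of a Hausdorff space. -/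
noncomputable abbrev toCWComplex [T2Space X] (hE : IsCellDecomposition E A) : CWComplex A :=
  CWComplex.mkFinite A (fun n => E n) (fun n e => (hE.isCell e.2).charMap)
    (Filter.eventually_atTop.2 ⟨3, fun n hn => isEmpty_coe_sort.2 (hE.eq_empty n hn)⟩)
    (fun n => (hE.finite n).to_subtype)
    (fun n e => rfl)
    (fun n e => (hE.isCell e.2).continuousOn_charMap)
    (fun n e => (hE.isCell e.2).continuousOn_charMap_symm (hE.disjoint_skeletonBelow e.2))
    (by
      rintro ⟨n, e⟩ - ⟨m, f⟩ - hne
      refine disjoint_left.2 fun x hx hx' => hne ?_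
      obtain ⟨rfl, h⟩ := hE.eq_of_mem e.2 f.2 ((hE.isCell e.2).charMap_image_ball.subset hx)
        ((hE.isCell f.2).charMap_image_ball.subset hx')
      rw [Subtype.ext h])
    (fun n e x hx => by
      obtain ⟨m, hm, f, hf | hf, hxf⟩ := (hE.isCell e.2).mapsTo_charMap hx
      · exact hf.elim
      · simp only [mem_iUnion]
        exact ⟨m, hm, ⟨f, hf⟩, (hE.isCell hf).subset_charMap_image_closedBall hxf⟩)
    (by
      refine Subset.antisymm (iUnion₂_subset fun n e => ?_) fun x hx => ?_
      · refine (hE.isCell e.2).charMap_image_closedBall_subset.trans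
          (union_subset ?_ (hE.subset e.2))
        rw [bot_sup_eq]
        exact fun x ⟨m, _, f, hf, hxf⟩ => hE.subset hf hxf
      · obtain ⟨n, e, he, hxe⟩ := hE.mem_iff.1 hx
        exact mem_iUnion₂.2 ⟨n, ⟨e, he⟩, (hE.isCell he).subset_charMap_image_closedBall hxe⟩)

end IsCellDecomposition

end CWComplexes

theorem HasEulerCharacteristic.exists_isCellDecomposition {A B : Set Space4} {χ : ℤ}
    (h : HasEulerCharacteristic A B χ) :
    ∃ E, IsCellDecomposition E A ∧ IsUnionOfCells E B ∧ cellCount E = χ := by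
  obtain ⟨_, hfin, hdim, ⟨I₀, I₁, rfl⟩, rfl⟩ := h
  refine ⟨openCells A, isCellDecomposition_openCells hfin hdim, ?_, ?_⟩
  · rintro x (hx | hx)
    · obtain ⟨i, hi, hxi⟩ := mem_iUnion₂.1 hx
      exact ⟨0, zero_le_one, _, ⟨i, rfl⟩, hxi, subset_union_of_subset_left
        (subset_biUnion_of_mem (u := fun i => RelCWComplex.openCell 0 i) hi) _⟩
    · obtain ⟨i, hi, hxi⟩ := mem_iUnion₂.1 hx
      exact ⟨1, le_rfl, _, ⟨i, rfl⟩, hxi, subset_union_of_subset_right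
        (subset_biUnion_of_mem (u := fun i => RelCWComplex.openCell 1 i) hi) _⟩
  · simp only [cellCount, ncard_openCells]

theorem IsCellDecomposition.hasEulerCharacteristic {E : ℕ → Set (Set Space4)} {A B : Set Space4}
    (hE : IsCellDecomposition E A) (hB : IsUnionOfCells E B) :
    HasEulerCharacteristic A B (cellCount E) := by
  let _ := hE.toCWComplex
  have hopen : ∀ n (e : E n), RelCWComplex.openCell (C := A) n e = e :=
    fun n e => (hE.isCell e.2).charMap_image_ball
  refine ⟨hE.toCWComplex, fun n => (hE.finite n).to_subtype,
    fun n hn => isEmpty_coe_sort.2 (hE.eq_empty n hn),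
    ⟨{e | (e : E 0).1 ⊆ B}, {e | (e : E 1).1 ⊆ B}, Subset.antisymm (fun x hx => ?_) ?_⟩, rfl⟩
  · obtain ⟨n, hn, e, he, hxe, hsub⟩ := hB x hx
    interval_cases n
    · exact Or.inl (mem_iUnion₂.2 ⟨⟨e, he⟩, hsub, (hopen 0 ⟨e, he⟩).symm ▸ hxe⟩)
    · exact Or.inr (mem_iUnion₂.2 ⟨⟨e, he⟩, hsub, (hopen 1 ⟨e, he⟩).symm ▸ hxe⟩)
  · exact union_subset (iUnion₂_subset fun e he => (hopen 0 e).trans_subset he)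
      (iUnion₂_subset fun e he => (hopen 1 e).trans_subset he)

section DisjointImages

variable {ι Y Z : Type*} {f : ι → Z → Y} {S T T' : Set Z}

theorem pairwise_disjoint_image (hf : ∀ i j, ∀ z ∈ S, ∀ w ∈ S, f i z = f j w → i = j ∧ z = w)
    (hT : T ⊆ S) : Pairwise (Disjoint on fun i => f i '' T) := by
  refine fun i j hij => disjoint_left.2 ?_
  rintro _ ⟨z, hz, rfl⟩ ⟨w, hw, h⟩
  exact hij (hf i j z (hT hz) w (hT hw) h.symm).1

theorem disjoint_iUnion_image (hf : ∀ i j, ∀ z ∈ S, ∀ w ∈ S, f i z = f j w → i = j ∧ z = w)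
    (hT : T ⊆ S) (hT' : T' ⊆ S) (hd : Disjoint T T') :
    Disjoint (⋃ i, f i '' T) (⋃ i, f i '' T') := by
  refine disjoint_iUnion_left.2 fun i => disjoint_iUnion_right.2 fun j => disjoint_left.2 ?_
  rintro _ ⟨z, hz, rfl⟩ ⟨w, hw, h⟩
  obtain ⟨-, rfl⟩ := hf i j z (hT hz) w (hT' hw) h.symm
  exact disjoint_left.1 hd hz hw

end DisjointImages

namespace OrientedLink

variable (K : OrientedLink)

theorem continuous_curve (i : Fin K.numComponents) : Continuous (K.curve i) :=
  (K.smooth i).continuous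

theorem curve_mem_range (i : Fin K.numComponents) (s : ℝ) : K.curve i s ∈ K.range :=
  mem_iUnion.2 ⟨i, s, rfl⟩

theorem isCompact_range_curve (i : Fin K.numComponents) : IsCompact (Set.range (K.curve i)) :=
  (K.periodic i).compact_of_continuous one_ne_zero (K.continuous_curve i)

theorem isCompact_range : IsCompact K.range := isCompact_iUnion K.isCompact_range_curve

theorem isClosed_slice (t : ℝ) : IsClosed (({t} : Set ℝ) ×ˢ K.range) :=
  isClosed_singleton.prod K.isCompact_range.isClosed

theorem eq_of_curve_eq {i : Fin K.numComponents} {s t : ℝ} (h : K.curve i s = K.curve i t)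
    (hst : |s - t| < 1) : s = t := by
  obtain ⟨-, k, rfl⟩ := K.injective i i s t h
  rw [add_sub_cancel_left, ← Int.cast_abs, ← Int.cast_one, Int.cast_lt, Int.abs_lt_one_iff] at hst
  rw [hst, Int.cast_zero, add_zero]

theorem curve_injective (i j : Fin K.numComponents) :
    ∀ s ∈ Ico (0 : ℝ) 1, ∀ t ∈ Ico (0 : ℝ) 1, K.curve i s = K.curve j t → i = j ∧ s = t := by
  intro s hs t ht h
  obtain rfl := (K.injective i j s t h).1
  exact ⟨rfl, K.eq_of_curve_eq h
    (abs_sub_lt_iff.2 ⟨by linarith [hs.2, ht.1], by linarith [hs.1, ht.2]⟩)⟩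

theorem iUnion_curve_image_Ico : ⋃ i, K.curve i '' Ico 0 1 = K.range :=
  iUnion_congr fun i => Subset.antisymm (image_subset_range _ _) <| range_subset_iff.2 fun s =>
    let ⟨t, ht, h⟩ := (K.periodic i).exists_mem_Ico₀ one_pos s
    ⟨t, ht, h.symm⟩

theorem exists_isCellDecomposition_range :
    ∃ E, IsCellDecomposition E K.range ∧ IsUnionOfCells E K.range ∧ cellCount E = 0 := by
  have hzero : ({0} : Set ℝ) ⊆ Ico 0 1 := singleton_subset_iff.2 (left_mem_Ico.2 one_pos)
  have hIoo : Ioo (0 : ℝ) 1 ⊆ Ico 0 1 := Ioo_subset_Ico_self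
  have hdV := pairwise_disjoint_image K.curve_injective hzero
  have hdE := pairwise_disjoint_image K.curve_injective hIoo
  have hd := disjoint_iUnion_image K.curve_injective hzero hIoo
    (disjoint_singleton_left.2 left_notMem_Ioo)
  have hvertices := isRelCellDecomposition_iUnion (D := ⊥) zero_le_two
    (fun i => by rw [image_singleton]; exact .of_singleton _ _) hdV
  have hedges := isRelCellDecomposition_iUnion
    (D := ⊥ ⊔ cellsOfDim 0 (Set.range fun i => K.curve i '' {0})) one_le_two (fun i => by
      have hmem : K.curve i 0 ∈
          skeletonBelow (⊥ ⊔ cellsOfDim 0 (Set.range fun i => K.curve i '' {0})) 1 :=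
        ⟨0, one_pos, _, Or.inr ⟨rfl, i, rfl⟩, 0, rfl, rfl⟩
      exact .of_interval (K.continuous_curve i).continuousOn
        (fun s hs t ht h => (K.curve_injective i i s (hIoo hs) t (hIoo ht) h).2)
        hmem ((K.periodic i).eq ▸ hmem)) hdE
  have hE := hvertices.sup hedges hd
  have hcover : (⋃ i, K.curve i '' {0}) ∪ ⋃ i, K.curve i '' Ioo 0 1 = K.range := by
    rw [← K.iUnion_curve_image_Ico, ← iUnion_union_distrib]
    exact iUnion_congr fun i => by
      rw [← image_union, singleton_union, Ioo_insert_left one_pos]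
  rw [hcover] at hE
  refine ⟨_, hE, fun x hx => ?_, ?_⟩
  · obtain ⟨n, e, he, hxe⟩ := hE.mem_iff.1 hx
    exact ⟨n, by rcases he with he | he <;> exact he.1.trans_le (by decide), e, he, hxe,
      hE.subset he⟩
  · rw [hvertices.cellCount_sup hedges hd,
      cellCount_cellsOfDim zero_le_two (fun i => (singleton_nonempty _).image _) hdV,
      cellCount_cellsOfDim one_le_two (fun i => (nonempty_Ioo.2 one_pos).image _) hdE]
    ring

theorem hasEulerCharacteristic_slice (t : ℝ) :
    HasEulerCharacteristic ({t} ×ˢ K.range) ({t} ×ˢ K.range) 0 := by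
  obtain ⟨E, hE, hEK, hcount⟩ := K.exists_isCellDecomposition_range
  have hinj : Injective fun p : Space3 => (t, p) := Prod.mk_right_injective t
  have himage := hE.image (by fun_prop) hinj
  rw [singleton_prod, ← hcount, ← cellCount_image hinj E]
  exact himage.hasEulerCharacteristic (hEK.image _)

theorem exists_vertex_slice {E : ℕ → Set (Set Space4)} {A : Set Space4} {t : ℝ}
    (hE : IsCellDecomposition E A) (hEK : IsUnionOfCells E ({t} ×ˢ K.range))
    (i : Fin K.numComponents) : ∃ s, {(t, K.curve i s)} ∈ E 0 := by
  have hrange : K.range = Set.range (K.curve i) ∪ ⋃ j ∈ ({i}ᶜ : Set _), Set.range (K.curve j) := by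
    rw [OrientedLink.range, ← biUnion_univ, ← union_compl_self {i}, biUnion_union,
      biUnion_singleton]
  have hclosed : IsClosed (({t} : Set ℝ) ×ˢ Set.range (K.curve i)) :=
    isClosed_singleton.prod (K.isCompact_range_curve i).isClosed
  have hclosed' : IsClosed (({t} : Set ℝ) ×ˢ ⋃ j ∈ ({i}ᶜ : Set _), Set.range (K.curve j)) :=
    isClosed_singleton.prod
      ((toFinite _).isClosed_biUnion fun j _ => (K.isCompact_range_curve j).isClosed)
  have hd : Disjoint (Set.range (K.curve i)) (⋃ j ∈ ({i}ᶜ : Set _), Set.range (K.curve j)) := by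
    simp only [disjoint_left, mem_iUnion, not_exists]
    rintro _ ⟨s, rfl⟩ j hj ⟨s', h⟩
    exact hj (K.injective _ _ _ _ h).1
  rw [hrange, prod_union] at hEK
  obtain ⟨⟨_, _⟩, ⟨rfl, s, rfl⟩, hs⟩ :=
    (hEK.of_union_left hE hclosed hclosed' (disjoint_prod.2 (Or.inr hd))).exists_vertex hE hclosed
      ⟨(t, K.curve i 0), rfl, 0, rfl⟩
  exact ⟨s, hs⟩

/-- The annuli `[t₁, t₂] × K`, sheared so that the paths `v = 0` lead from the points
`(t₁, K.curve i (a i))` to the points `(t₂, K.curve i (b i))`. -/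
noncomputable def collarMap (t₁ t₂ : ℝ) (a b : Fin K.numComponents → ℝ) (i : Fin K.numComponents)
    (p : ℝ × ℝ) : Space4 :=
  (lineMap t₁ t₂ p.1, K.curve i (lineMap (a i) (b i) p.1 + p.2))

section Collar

variable {K} {t₁ t₂ : ℝ} {a b : Fin K.numComponents → ℝ} {S : Set Space4}

theorem continuous_collarMap (i : Fin K.numComponents) : Continuous (K.collarMap t₁ t₂ a b i) := by
  have := K.continuous_curve i
  unfold collarMap
  simp only [lineMap_apply_module]
  fun_prop

theorem collarMap_injective (ht : t₁ ≠ t₂) (i j : Fin K.numComponents) :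
    ∀ p ∈ univ ×ˢ Ico (0 : ℝ) 1, ∀ q ∈ univ ×ˢ Ico (0 : ℝ) 1,
      K.collarMap t₁ t₂ a b i p = K.collarMap t₁ t₂ a b j q → i = j ∧ p = q := by
  rintro ⟨s, v⟩ ⟨-, hv⟩ ⟨s', w⟩ ⟨-, hw⟩ h
  obtain ⟨hs, hcurve⟩ := Prod.mk.inj h
  obtain rfl : s = s' := lineMap_injective ℝ ht hs
  obtain rfl := (K.injective _ _ _ _ hcurve).1
  have hvw := K.eq_of_curve_eq hcurve (by
    rw [add_sub_add_left_eq_sub]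
    exact abs_sub_lt_iff.2 ⟨by linarith [hv.2, hw.1], by linarith [hv.1, hw.2]⟩)
  exact ⟨rfl, Prod.ext rfl (add_left_cancel hvw)⟩

theorem iUnion_collarMap_image (ht : t₁ < t₂) :
    ⋃ i, K.collarMap t₁ t₂ a b i '' Ioo 0 1 ×ˢ Ico 0 1 = Ioo t₁ t₂ ×ˢ K.range := by
  have htime : lineMap t₁ t₂ '' Ioo (0 : ℝ) 1 = Ioo t₁ t₂ := by
    rw [← openSegment_eq_image_lineMap, openSegment_eq_Ioo ht]
  refine Subset.antisymm (iUnion_subset fun i => ?_) ?_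
  · rintro _ ⟨⟨s, v⟩, ⟨hs, -⟩, rfl⟩
    exact ⟨htime ▸ mem_image_of_mem _ hs, K.curve_mem_range _ _⟩
  · rintro ⟨t, p⟩ ⟨ht, hp⟩
    rw [← htime] at ht
    obtain ⟨s, hs, rfl⟩ := ht
    obtain ⟨i, u, rfl⟩ := mem_iUnion.1 hp
    obtain ⟨y, hy, hcurve⟩ := (K.periodic i).exists_mem_Ico one_pos u (lineMap (a i) (b i) s)
    refine mem_iUnion.2 ⟨i, (s, y - lineMap (a i) (b i) s),
      ⟨hs, sub_nonneg.2 hy.1, by linarith [hy.2]⟩, ?_⟩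
    simp only [collarMap, add_sub_cancel, hcurve]

theorem isCell_arc (ht : t₁ ≠ t₂) {i : Fin K.numComponents} (h₁ : (t₁, K.curve i (a i)) ∈ S)
    (h₂ : (t₂, K.curve i (b i)) ∈ S) :
    IsCell S 1 (K.collarMap t₁ t₂ a b i '' Ioo 0 1 ×ˢ {0}) := by
  rw [prod_singleton, image_image]
  refine .of_interval ((continuous_collarMap i).comp (by fun_prop)).continuousOn ?_ ?_ ?_
  · intro s _ s' _ h
    exact congrArg Prod.fst (collarMap_injective ht i i (s, 0) ⟨trivial, left_mem_Ico.2 one_pos⟩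
      (s', 0) ⟨trivial, left_mem_Ico.2 one_pos⟩ h).2
  · simpa [collarMap] using h₁
  · simpa [collarMap] using h₂

theorem isCell_face (ht : t₁ ≠ t₂) (i : Fin K.numComponents) (h₁ : {t₁} ×ˢ K.range ⊆ S)
    (h₂ : {t₂} ×ˢ K.range ⊆ S) (harc : K.collarMap t₁ t₂ a b i '' Ioo 0 1 ×ˢ {0} ⊆ S) :
    IsCell S 2 (K.collarMap t₁ t₂ a b i '' Ioo 0 1 ×ˢ Ioo 0 1) := by
  refine .of_square (continuous_collarMap i).continuousOn
    (fun p hp q hq h => (collarMap_injective ht i i p ⟨trivial, Ioo_subset_Ico_self hp.2⟩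
      q ⟨trivial, Ioo_subset_Ico_self hq.2⟩ h).2) ?_
  rintro ⟨s, v⟩ ⟨⟨hs, hv⟩, hnot⟩
  by_cases hs' : s ∈ Ioo (0 : ℝ) 1
  · have hvmem : v ∈ ({0, 1} : Set ℝ) := by
      rw [← Icc_sdiff_Ioo_same zero_le_one]
      exact ⟨hv, fun hv' => hnot ⟨hs', hv'⟩⟩
    refine harc ⟨(s, 0), ⟨hs', rfl⟩, ?_⟩
    rcases hvmem with rfl | rfl
    · rfl
    · simp only [collarMap, add_zero, K.periodic i _]
  · have hsmem : s ∈ ({0, 1} : Set ℝ) := by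
      rw [← Icc_sdiff_Ioo_same zero_le_one]
      exact ⟨hs, hs'⟩
    rcases hsmem with rfl | rfl
    · exact h₁ ⟨lineMap_apply_zero _ _, K.curve_mem_range _ _⟩
    · exact h₂ ⟨lineMap_apply_one _ _, K.curve_mem_range _ _⟩

theorem exists_isRelCellDecomposition_collar {D : ℕ → Set (Set Space4)} (ht : t₁ < t₂)
    (h₁ : IsUnionOfCells D ({t₁} ×ˢ K.range)) (h₂ : IsUnionOfCells D ({t₂} ×ˢ K.range))
    (ha : ∀ i, {(t₁, K.curve i (a i))} ∈ D 0) (hb : ∀ i, {(t₂, K.curve i (b i))} ∈ D 0) :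
    ∃ E, IsRelCellDecomposition D E (Ioo t₁ t₂ ×ˢ K.range) ∧ cellCount E = 0 := by
  have hzero : Ioo (0 : ℝ) 1 ×ˢ ({0} : Set ℝ) ⊆ univ ×ˢ Ico 0 1 :=
    prod_mono (subset_univ _) (singleton_subset_iff.2 (left_mem_Ico.2 one_pos))
  have hIoo : Ioo (0 : ℝ) 1 ×ˢ Ioo (0 : ℝ) 1 ⊆ univ ×ˢ Ico 0 1 :=
    prod_mono (subset_univ _) Ioo_subset_Ico_self
  have hinj := collarMap_injective (a := a) (b := b) ht.ne
  have hdA := pairwise_disjoint_image hinj hzero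
  have hdF := pairwise_disjoint_image hinj hIoo
  have hd := disjoint_iUnion_image hinj hzero hIoo
    (disjoint_prod.2 (Or.inr (disjoint_singleton_left.2 left_notMem_Ioo)))
  have harcs := isRelCellDecomposition_iUnion (D := D) one_le_two
    (fun i => isCell_arc ht.ne ⟨0, one_pos, _, ha i, rfl⟩ ⟨0, one_pos, _, hb i, rfl⟩) hdA
  have hfaces := isRelCellDecomposition_iUnion (D := D ⊔ cellsOfDim 1 (Set.range fun i =>
      K.collarMap t₁ t₂ a b i '' Ioo 0 1 ×ˢ {0})) le_rfl
    (fun i => isCell_face ht.ne i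
      (h₁.subset_skeletonBelow.trans (skeletonBelow_mono le_sup_left 2))
      (h₂.subset_skeletonBelow.trans (skeletonBelow_mono le_sup_left 2))
      fun x hx => ⟨1, one_lt_two, _, Or.inr ⟨rfl, i, rfl⟩, hx⟩) hdF
  have hcover : (⋃ i, K.collarMap t₁ t₂ a b i '' Ioo 0 1 ×ˢ {0}) ∪
      ⋃ i, K.collarMap t₁ t₂ a b i '' Ioo 0 1 ×ˢ Ioo 0 1 = Ioo t₁ t₂ ×ˢ K.range := by
    rw [← iUnion_collarMap_image ht, ← iUnion_union_distrib]
    exact iUnion_congr fun i => by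
      rw [← image_union, ← prod_union, singleton_union, Ioo_insert_left one_pos]
  refine ⟨_, hcover ▸ harcs.sup hfaces hd, ?_⟩
  have hne := nonempty_Ioo.2 (one_pos (α := ℝ))
  rw [harcs.cellCount_sup hfaces hd,
    cellCount_cellsOfDim one_le_two (fun i => (hne.prod (singleton_nonempty 0)).image _) hdA,
    cellCount_cellsOfDim le_rfl (fun i => (hne.prod hne).image _) hdF]
  ring

end Collar

end OrientedLink

namespace HasEulerCharacteristic

variable {A B C A₁ A₂ P R : Set Space4} {χ χ₁ χ₂ : ℤ}

theorem subset (h : HasEulerCharacteristic A B χ) : B ⊆ A := fun _ hx =>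
  let ⟨_, hE, hB, _⟩ := h.exists_isCellDecomposition
  let ⟨_, _, _, he, hxe⟩ := hB.subset_skeletonBelow hx
  hE.subset he hxe

theorem preimage (h : HasEulerCharacteristic A B χ) (f : Space4 ≃ₜ Space4) :
    HasEulerCharacteristic (f ⁻¹' A) (f ⁻¹' B) χ := by
  obtain ⟨E, hE, hB, rfl⟩ := h.exists_isCellDecomposition
  rw [← f.image_symm, ← cellCount_image f.symm.injective E]
  exact (hE.image f.symm.continuous f.symm.injective).hasEulerCharacteristic (hB.image _)

theorem of_union_left (h : HasEulerCharacteristic A (B ∪ C) χ) (hB : IsClosed B) (hC : IsClosed C)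
    (hd : Disjoint B C) : HasEulerCharacteristic A B χ := by
  obtain ⟨E, hE, hBC, rfl⟩ := h.exists_isCellDecomposition
  exact hE.hasEulerCharacteristic (hBC.of_union_left hE hB hC hd)

/-- Every component of the collar contributes one arc and one face. -/
theorem union_collar {K : OrientedLink} {t₁ t₂ : ℝ} (ht : t₁ < t₂)
    (h₁ : HasEulerCharacteristic A₁ (P ∪ {t₁} ×ˢ K.range) χ₁)
    (h₂ : HasEulerCharacteristic A₂ ({t₂} ×ˢ K.range ∪ R) χ₂)
    (hA₁ : ∀ q ∈ A₁, q.1 ≤ t₁) (hA₂ : ∀ q ∈ A₂, t₂ ≤ q.1)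
    (hP : IsClosed P) (hPt : ∀ q ∈ P, q.1 < t₁) (hR : IsClosed R) (hRt : ∀ q ∈ R, t₂ < q.1) :
    HasEulerCharacteristic (A₁ ∪ A₂ ∪ Icc t₁ t₂ ×ˢ K.range)
      (P ∪ {t₁} ×ˢ K.range ∪ ({t₂} ×ˢ K.range ∪ R)) (χ₁ + χ₂) := by
  have hopen : A₁ ∪ A₂ ∪ Icc t₁ t₂ ×ˢ K.range = A₁ ∪ A₂ ∪ Ioo t₁ t₂ ×ˢ K.range := by
    rw [← Ioo_union_both ht.le, insert_eq, union_prod, union_prod, union_comm (_ ×ˢ _),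
      ← union_assoc, union_eq_self_of_subset_right (union_subset_union
        (subset_union_right.trans h₁.subset) (subset_union_left.trans h₂.subset))]
  obtain ⟨E₁, hE₁, hB₁, rfl⟩ := h₁.exists_isCellDecomposition
  obtain ⟨E₂, hE₂, hB₂, rfl⟩ := h₂.exists_isCellDecomposition
  have hdA : Disjoint A₁ A₂ :=
    disjoint_left.2 fun q hq hq' => ((hA₁ q hq).trans_lt ht).not_ge (hA₂ q hq')
  have hdC : Disjoint (A₁ ∪ A₂) (Ioo t₁ t₂ ×ˢ K.range) := disjoint_union_left.2
    ⟨disjoint_left.2 fun q hq hq' => hq'.1.1.not_ge (hA₁ q hq),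
      disjoint_left.2 fun q hq hq' => hq'.1.2.not_ge (hA₂ q hq)⟩
  have hdP : Disjoint ({t₁} ×ˢ K.range) P := disjoint_left.2 fun q hq hq' => (hPt q hq').ne hq.1
  have hdR : Disjoint ({t₂} ×ˢ K.range) R := disjoint_left.2 fun q hq hq' => (hRt q hq').ne' hq.1
  have hK₁ := (union_comm P _ ▸ hB₁).of_union_left hE₁ (K.isClosed_slice t₁) hP hdP
  have hK₂ := hB₂.of_union_left hE₂ (K.isClosed_slice t₂) hR hdR
  choose a ha using K.exists_vertex_slice hE₁ hK₁
  choose b hb using K.exists_vertex_slice hE₂ hK₂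
  have hE := hE₁.sup (hE₂.mono bot_le) hdA
  obtain ⟨F, hF, hcount⟩ := OrientedLink.exists_isRelCellDecomposition_collar ht
    (hK₁.mono le_sup_left) (hK₂.mono le_sup_right) (fun i => Or.inl (ha i)) fun i => Or.inr (hb i)
  have hsup : IsCellDecomposition (E₁ ⊔ E₂ ⊔ F) _ := hE.sup (hF.mono le_sup_right) hdC
  have hχ : cellCount (E₁ ⊔ E₂ ⊔ F) = cellCount E₁ + cellCount E₂ := by
    rw [hE.cellCount_sup hF hdC, hE₁.cellCount_sup hE₂ hdA, hcount, add_zero]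
  rw [hopen, ← hχ]
  exact hsup.hasEulerCharacteristic
    ((hB₁.mono (le_sup_left.trans le_sup_left)).union (hB₂.mono (le_sup_right.trans le_sup_left)))

theorem collar_lower {K : OrientedLink} {t₁ t₂ : ℝ} (ht : t₁ < t₂)
    (h : HasEulerCharacteristic A ({t₂} ×ˢ K.range ∪ R) χ) (hA : ∀ q ∈ A, t₂ ≤ q.1)
    (hR : IsClosed R) (hRt : ∀ q ∈ R, t₂ < q.1) :
    HasEulerCharacteristic (A ∪ Icc t₁ t₂ ×ˢ K.range) ({t₁} ×ˢ K.range ∪ R) χ := by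
  have hcollar := union_collar (A₁ := {t₁} ×ˢ K.range) (P := ∅) ht
    (by simpa only [empty_union] using K.hasEulerCharacteristic_slice t₁) h
    (fun _ hq => hq.1.le) hA isClosed_empty (fun _ hq => hq.elim) hR hRt
  have hslice : {t₁} ×ˢ K.range ⊆ Icc t₁ t₂ ×ˢ K.range :=
    prod_mono_left (singleton_subset_iff.2 (left_mem_Icc.2 ht.le))
  rw [union_assoc, union_eq_self_of_subset_left (hslice.trans subset_union_right), zero_add,
    empty_union, union_left_comm, union_comm ({t₂} ×ˢ _)] at hcollar
  refine hcollar.of_union_left ((K.isClosed_slice t₁).union hR) (K.isClosed_slice t₂) ?_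
  exact disjoint_union_left.2 ⟨disjoint_prod.2 (Or.inl (disjoint_singleton.2 ht.ne)),
    disjoint_left.2 fun q hq hq' => (hRt q hq).ne' hq'.1⟩

theorem collar_upper {K : OrientedLink} {t₁ t₂ : ℝ} (ht : t₁ < t₂)
    (h : HasEulerCharacteristic A (P ∪ {t₁} ×ˢ K.range) χ) (hA : ∀ q ∈ A, q.1 ≤ t₁)
    (hP : IsClosed P) (hPt : ∀ q ∈ P, q.1 < t₁) :
    HasEulerCharacteristic (A ∪ Icc t₁ t₂ ×ˢ K.range) (P ∪ {t₂} ×ˢ K.range) χ := by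
  have hcollar := union_collar (A₂ := {t₂} ×ˢ K.range) (R := ∅) ht h
    (by simpa only [union_empty] using K.hasEulerCharacteristic_slice t₂) hA (fun _ hq => hq.1.ge)
    hP hPt isClosed_empty (fun _ hq => hq.elim)
  have hslice : {t₂} ×ˢ K.range ⊆ Icc t₁ t₂ ×ˢ K.range :=
    prod_mono_left (singleton_subset_iff.2 (right_mem_Icc.2 ht.le))
  rw [union_assoc, union_eq_self_of_subset_left hslice, add_zero, union_empty,
    union_right_comm] at hcollar
  refine hcollar.of_union_left (hP.union (K.isClosed_slice t₂)) (K.isClosed_slice t₁) ?_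
  exact disjoint_union_left.2 ⟨disjoint_left.2 fun q hq hq' => (hPt q hq).ne hq'.1,
    disjoint_prod.2 (Or.inl (disjoint_singleton.2 ht.ne'))⟩

end HasEulerCharacteristic

section TangentCones

variable {E F : Type*} [NormedAddCommGroup E] [NormedSpace ℝ E] [NormedAddCommGroup F]
  [NormedSpace ℝ F] {S S' U : Set E} {p : E}

theorem tangentConeAt_congr_of_isOpen (hU : IsOpen U) (hp : p ∈ U) (h : S ∩ U = S' ∩ U) :
    tangentConeAt ℝ S p = tangentConeAt ℝ S' p := by
  rw [← tangentConeAt_inter_nhds (hU.mem_nhds hp), h, tangentConeAt_inter_nhds (hU.mem_nhds hp)]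

theorem mem_tangentConeAt_of_hasDerivAt {γ : ℝ → E} {v : E} {s : ℝ} (hγ : HasDerivAt γ v s)
    (hS : ∀ᶠ s' in 𝓝 s, γ s' ∈ S) : v ∈ tangentConeAt ℝ S (γ s) := by
  have hone : (1 : ℝ) ∈ tangentConeAt ℝ (γ ⁻¹' S) s := by
    rw [tangentConeAt_of_mem_nhds (s := γ ⁻¹' S) hS]
    trivial
  have h := tangentConeAt_mono (image_preimage_subset γ S)
    (hγ.hasFDerivAt.hasFDerivWithinAt.mapsTo_tangent_cone hone)
  simpa using h

theorem tangentConeAt_subset_ker {f : E → F} {f' : E →L[ℝ] F} {c : F} (hf : HasFDerivAt f f' p)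
    (hS : S ⊆ f ⁻¹' {c}) : tangentConeAt ℝ S p ⊆ f'.ker := by
  intro u hu
  have hc : ¬AccPt (f p) (Filter.principal {c}) := fun h =>
    Set.Infinite.of_accPt h (finite_singleton c)
  exact tangentConeAt_subset_zero (𝕜 := ℝ) hc
    (tangentConeAt_mono (image_subset_iff.2 hS) (hf.hasFDerivWithinAt.mapsTo_tangent_cone hu))

theorem apply_mul_apply_comm {V : Submodule ℝ E} [FiniteDimensional ℝ V]
    (hV : Module.finrank ℝ V ≤ 2) {B B' : E →L[ℝ] E →L[ℝ] ℝ} (hB : ∀ w, B w w = 0)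
    (hB' : ∀ w, B' w w = 0) {u v e f : E} (hu : u ∈ V) (hv : v ∈ V) (he : e ∈ V) (hf : f ∈ V)
    (huv : LinearIndependent ℝ ![u, v]) :
    B u v * B' e f = B' u v * B e f := by
  have hspan : Submodule.span ℝ {u, v} = V := by
    refine Submodule.eq_of_le_of_finrank_le (Submodule.span_le.2 (pair_subset hu hv)) ?_
    have hcard := finrank_span_eq_card huv
    rw [Matrix.range_cons_cons_empty, Fintype.card_fin] at hcard
    exact hV.trans_eq hcard.symm
  have hskew : ∀ {A : E →L[ℝ] E →L[ℝ] ℝ}, (∀ w, A w w = 0) → A v u = -A u v := fun {A} hA => by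
    have hsum := hA (u + v)
    simp only [map_add, add_apply, hA] at hsum
    linarith
  rw [← hspan] at he hf
  obtain ⟨a, b, rfl⟩ := Submodule.mem_span_pair.1 he
  obtain ⟨c, d, rfl⟩ := Submodule.mem_span_pair.1 hf
  simp only [map_add, map_smul, add_apply, smul_apply, hB, hB', hskew hB, hskew hB', smul_eq_mul]
  ring

end TangentCones

namespace IsSmoothSurface

variable {S : Set Space4}

theorem of_locally (h : ∀ p ∈ S, ∃ S' U, IsSmoothSurface S' ∧ IsOpen U ∧ p ∈ U ∧
    S ∩ U = S' ∩ U) : IsSmoothSurface S := by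
  intro p hp
  obtain ⟨S', U, hS', hU, hpU, hSU⟩ := h p hp
  have hiff : ∀ q ∈ U, (q ∈ S ↔ q ∈ S') := fun q hq => by
    simpa only [mem_inter_iff, hq, and_true] using Set.ext_iff.1 hSU q
  obtain ⟨Φ, hpΦ, hΦ, hΦsymm, hflat⟩ := hS' p ((hiff p hpU).1 hp)
  exact ⟨Φ.restrOpen U hU, ⟨hpΦ, hpU⟩, hΦ.mono inter_subset_left, hΦsymm.mono inter_subset_left,
    fun q hq => (hiff q hq.2).trans (hflat q hq.1)⟩

theorem inter_isOpen (hS : IsSmoothSurface S) {U : Set Space4} (hU : IsOpen U) :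
    IsSmoothSurface (S ∩ U) :=
  .of_locally fun _ hp => ⟨S, U, hS, hU, hp.2, by rw [inter_assoc, inter_self]⟩

theorem exists_tangentConeAt_subset (hS : IsSmoothSurface S) {p : Space4} (hp : p ∈ S) :
    ∃ V : Submodule ℝ Space4, Module.finrank ℝ V ≤ 2 ∧ tangentConeAt ℝ S p ⊆ V := by
  obtain ⟨Φ, hpΦ, hΦ, hΦsymm, hflat⟩ := hS p hp
  have hD : HasFDerivAt Φ (fderiv ℝ Φ p) p := ((hΦ.contDiffAt
    (Φ.open_source.mem_nhds hpΦ)).differentiableAt (by simp)).hasFDerivAt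
  have hD' : HasFDerivAt Φ.symm (fderiv ℝ Φ.symm (Φ p)) (Φ p) := ((hΦsymm.contDiffAt
    (Φ.open_target.mem_nhds (Φ.map_source hpΦ))).differentiableAt (by simp)).hasFDerivAt
  have hid : (fderiv ℝ Φ.symm (Φ p)).comp (fderiv ℝ Φ p) = ContinuousLinearMap.id ℝ Space4 :=
    (hD'.comp p hD).unique ((hasFDerivAt_id p).congr_of_eventuallyEq
      (Filter.mem_of_superset (Φ.open_source.mem_nhds hpΦ) fun q hq => Φ.left_inv hq))
  let L := (fderiv ℝ Φ.symm (Φ p)).comp (ContinuousLinearMap.inl ℝ (ℝ × ℝ) (ℝ × ℝ))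
  refine ⟨L.range, ?_, fun u hu => ⟨(fderiv ℝ Φ p u).1, ?_⟩⟩
  · simpa using LinearMap.finrank_range_le L.toLinearMap
  · rw [← tangentConeAt_inter_nhds (Φ.open_source.mem_nhds hpΦ)] at hu
    have hsnd : (fderiv ℝ Φ p u).2 = 0 := tangentConeAt_subset_ker
      (f := fun q => (Φ q).2) (f' := (ContinuousLinearMap.snd ℝ _ _).comp (fderiv ℝ Φ p))
      (hasFDerivAt_snd.comp p hD) (fun q hq => (hflat q hq.2).1 hq.1) hu
    have hinl : ((fderiv ℝ Φ p u).1, (0 : ℝ × ℝ)) = fderiv ℝ Φ p u := Prod.ext rfl hsnd.symm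
    exact (congrArg (fderiv ℝ Φ.symm (Φ p)) hinl).trans (DFunLike.congr_fun hid u)

end IsSmoothSurface

namespace IsOrientationForm

variable {S : Set Space4} {Ω Ω₁ Ω₂ : Space4 → Space4 →L[ℝ] Space4 →L[ℝ] ℝ}

theorem of_locally (h : ∀ p ∈ S, ∃ S' Ω' U, IsOrientationForm S' Ω' ∧ IsOpen U ∧ p ∈ U ∧
    S ∩ U = S' ∩ U ∧ EqOn Ω Ω' U) : IsOrientationForm S Ω where
  continuousOn := continuousOn_of_locally_continuousOn fun p hp =>
    let ⟨_, _, U, hΩ', hU, hpU, hSU, heq⟩ := h p hp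
    ⟨U, hU, hpU, (hΩ'.continuousOn.mono (hSU.trans_subset inter_subset_left)).congr
      (heq.mono inter_subset_right)⟩
  alternating p hp u := by
    obtain ⟨S', Ω', U, hΩ', -, hpU, hSU, heq⟩ := h p hp
    rw [heq hpU]
    exact hΩ'.alternating p (hSU.subset ⟨hp, hpU⟩).1 u
  nonvanishing p hp u hu v hv huv := by
    obtain ⟨S', Ω', U, hΩ', hU, hpU, hSU, heq⟩ := h p hp
    rw [heq hpU]
    rw [tangentConeAt_congr_of_isOpen hU hpU hSU] at hu hv
    exact hΩ'.nonvanishing p (hSU.subset ⟨hp, hpU⟩).1 u hu v hv huv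

theorem inter_isOpen (hΩ : IsOrientationForm S Ω) {U : Set Space4} (hU : IsOpen U) :
    IsOrientationForm (S ∩ U) Ω :=
  .of_locally fun _ hp =>
    ⟨S, Ω, U, hΩ, hU, hp.2, by rw [inter_assoc, inter_self], eqOn_refl _ _⟩

/-- On a tangent plane the two forms are proportional, with a positive factor. -/
theorem lineMap (hS : IsSmoothSurface S) (h₁ : IsOrientationForm S Ω₁)
    (h₂ : IsOrientationForm S Ω₂) {φ : Space4 → ℝ} (hφ : ContinuousOn φ S)
    (hφmem : ∀ p ∈ S, φ p ∈ Icc 0 1) (hpos : ∀ p ∈ S, ∃ e ∈ tangentConeAt ℝ S p,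
      ∃ f ∈ tangentConeAt ℝ S p, 0 < Ω₁ p e f ∧ 0 < Ω₂ p e f) :
    IsOrientationForm S fun p => AffineMap.lineMap (Ω₁ p) (Ω₂ p) (φ p) where
  continuousOn := by
    simp only [lineMap_apply_module]
    refine continuousOn_clm_apply.2 fun u => continuousOn_clm_apply.2 fun v => ?_
    have heval : ∀ {Ω : Space4 → Space4 →L[ℝ] Space4 →L[ℝ] ℝ}, IsOrientationForm S Ω →
        ContinuousOn (fun p => Ω p u v) S := fun h =>
      (h.continuousOn.clm_apply continuousOn_const).clm_apply continuousOn_const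
    exact ((continuousOn_const.sub hφ).mul (heval h₁)).add (hφ.mul (heval h₂))
  alternating p hp u := by
    simp [lineMap_apply_module, h₁.alternating p hp u, h₂.alternating p hp u]
  nonvanishing p hp u hu v hv huv := by
    obtain ⟨V, hV, hSV⟩ := hS.exists_tangentConeAt_subset hp
    obtain ⟨e, he, f, hf, hpos₁, hpos₂⟩ := hpos p hp
    obtain ⟨hφ₀, hφ₁⟩ := hφmem p hp
    have hprop := apply_mul_apply_comm hV (h₁.alternating p hp) (h₂.alternating p hp) (hSV hu)
      (hSV hv) (hSV he) (hSV hf) huv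
    have hcomb : AffineMap.lineMap (Ω₁ p u v) (Ω₂ p u v) (φ p) * Ω₂ p e f =
        Ω₂ p u v * AffineMap.lineMap (Ω₁ p e f) (Ω₂ p e f) (φ p) := by
      simp only [lineMap_apply_module, smul_eq_mul]
      linear_combination (1 - φ p) * hprop
    have hmem : 0 < AffineMap.lineMap (Ω₁ p e f) (Ω₂ p e f) (φ p) :=
      (convex_Ioi (0 : ℝ)).lineMap_mem hpos₁ hpos₂ ⟨hφ₀, hφ₁⟩
    refine left_ne_zero_of_mul (b := Ω₂ p e f) ?_
    have := mul_ne_zero (h₂.nonvanishing p hp u hu v hv huv) hmem.ne'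
    rwa [← hcomb] at this

end IsOrientationForm

namespace OrientedLink

variable (K : OrientedLink) {I : Set ℝ} {t : ℝ} (i : Fin K.numComponents) (s : ℝ)

/-- The form `Ω` is positive on the product orientation of the cylinder `ℝ × K` over `t`. -/
def IsPositiveAt (Ω : Space4 → Space4 →L[ℝ] Space4 →L[ℝ] ℝ) (t : ℝ) : Prop :=
  ∀ i s, 0 < Ω (t, K.curve i s) (1, 0) (0, deriv (K.curve i) s)

theorem axis_mem_tangentConeAt (hI : I ∈ 𝓝 t) :
    (1, 0) ∈ tangentConeAt ℝ (I ×ˢ K.range) (t, K.curve i s) :=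
  mem_tangentConeAt_of_hasDerivAt ((hasDerivAt_id t).prodMk (hasDerivAt_const t (K.curve i s)))
    (Filter.mem_of_superset hI fun _ h => ⟨h, K.curve_mem_range i s⟩)

theorem velocity_mem_tangentConeAt (ht : t ∈ I) :
    (0, deriv (K.curve i) s) ∈ tangentConeAt ℝ (I ×ˢ K.range) (t, K.curve i s) :=
  mem_tangentConeAt_of_hasDerivAt (γ := fun σ => (t, K.curve i σ)) ((hasDerivAt_const s t).prodMk
    ((K.smooth i).differentiable (by simp)).differentiableAt.hasDerivAt)
    (Filter.Eventually.of_forall fun σ => ⟨ht, K.curve_mem_range i σ⟩)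

end OrientedLink

section Rescale

variable {a b : ℝ}

/-- The affine change `t ↦ a t + b` of the first coordinate of `ℝ × ℝ³`. -/
noncomputable def rescale (a b : ℝ) (ha : a ≠ 0) : Space4 ≃ₜ Space4 where
  toFun q := (a * q.1 + b, q.2)
  invFun q := (a⁻¹ * (q.1 - b), q.2)
  left_inv q := Prod.ext (by field_simp; ring) rfl
  right_inv q := Prod.ext (by field_simp; ring) rfl

theorem rescale_apply (ha : a ≠ 0) (q : Space4) : rescale a b ha q = (a * q.1 + b, q.2) := rfl

/-- The linear part of `rescale`. -/
noncomputable def rescaleLinear (a : ℝ) : Space4 →L[ℝ] Space4 :=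
  (a • ContinuousLinearMap.fst ℝ ℝ Space3).prod (ContinuousLinearMap.snd ℝ ℝ Space3)

theorem rescaleLinear_injective (ha : a ≠ 0) : Injective (rescaleLinear a) := fun _ _ h =>
  let ⟨hfst, hsnd⟩ := Prod.mk.inj h
  Prod.ext (mul_left_cancel₀ ha hfst) hsnd

theorem hasFDerivAt_rescale (ha : a ≠ 0) (q : Space4) :
    HasFDerivAt (rescale a b ha) (rescaleLinear a) q :=
  ((hasFDerivAt_fst.const_mul a).add_const b).prodMk hasFDerivAt_snd

theorem rescaleLinear_mem_tangentConeAt {S : Set Space4} {p u : Space4} (ha : a ≠ 0)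
    (hu : u ∈ tangentConeAt ℝ (rescale a b ha ⁻¹' S) p) :
    rescaleLinear a u ∈ tangentConeAt ℝ S (rescale a b ha p) :=
  tangentConeAt_mono (image_preimage_subset _ _)
    ((hasFDerivAt_rescale ha p).hasFDerivWithinAt.mapsTo_tangent_cone hu)

theorem IsSmoothSurface.preimage_rescale {S : Set Space4} (hS : IsSmoothSurface S) (ha : a ≠ 0) :
    IsSmoothSurface (rescale a b ha ⁻¹' S) := by
  have hsmooth : ContDiff ℝ ∞ (rescale a b ha) :=
    ((contDiff_const.mul contDiff_fst).add contDiff_const).prodMk contDiff_snd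
  have hsymm : ContDiff ℝ ∞ (rescale a b ha).symm :=
    (contDiff_const.mul (contDiff_fst.sub contDiff_const)).prodMk contDiff_snd
  intro p hp
  obtain ⟨Φ, hpΦ, hΦ, hΦsymm, hflat⟩ := hS _ hp
  exact ⟨(rescale a b ha).transOpenPartialHomeomorph Φ, hpΦ,
    hΦ.comp hsmooth.contDiffOn fun _ hq => hq, hsymm.comp_contDiffOn hΦsymm, fun q hq => hflat _ hq⟩

/-- The pullback of `Ω` under `rescale`, times `a`: the factor makes the form positive again on
cylinders with the product orientation when `a < 0`. -/
noncomputable def rescaledForm (a b : ℝ) (ha : a ≠ 0) (Ω : Space4 → Space4 →L[ℝ] Space4 →L[ℝ] ℝ)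
    (q : Space4) : Space4 →L[ℝ] Space4 →L[ℝ] ℝ :=
  a • (Ω (rescale a b ha q)).bilinearComp (rescaleLinear a) (rescaleLinear a)

variable {Ω : Space4 → Space4 →L[ℝ] Space4 →L[ℝ] ℝ}

theorem rescaledForm_apply (ha : a ≠ 0) (q u v : Space4) :
    rescaledForm a b ha Ω q u v =
      a * Ω (rescale a b ha q) (rescaleLinear a u) (rescaleLinear a v) := rfl

theorem IsOrientationForm.rescaledForm {S : Set Space4} (hΩ : IsOrientationForm S Ω)
    (ha : a ≠ 0) : IsOrientationForm (rescale a b ha ⁻¹' S) (rescaledForm a b ha Ω) where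
  continuousOn := by
    refine continuousOn_clm_apply.2 fun u => continuousOn_clm_apply.2 fun v => ?_
    have hcomp := hΩ.continuousOn.comp (rescale a b ha).continuous.continuousOn
      (mapsTo_preimage _ _)
    exact ((hcomp.clm_apply continuousOn_const).clm_apply continuousOn_const).const_smul a
  alternating p hp u := by rw [rescaledForm_apply, hΩ.alternating _ hp, mul_zero]
  nonvanishing p hp u hu v hv huv := by
    have hindep := huv.map' (rescaleLinear a).toLinearMap
      (LinearMap.ker_eq_bot.2 (rescaleLinear_injective ha))
    rw [← FinVec.map_eq] at hindep
    exact mul_ne_zero ha (hΩ.nonvanishing _ hp _ (rescaleLinear_mem_tangentConeAt ha hu) _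
      (rescaleLinear_mem_tangentConeAt ha hv) hindep)

theorem OrientedLink.IsPositiveAt.rescaledForm {K : OrientedLink} {t : ℝ} (ha : a ≠ 0)
    (h : K.IsPositiveAt Ω (a * t + b)) : K.IsPositiveAt (rescaledForm a b ha Ω) t := fun i s => by
  have haxis : rescaleLinear a (1, 0) = a • ((1, 0) : Space4) :=
    Prod.ext rfl (smul_zero a).symm
  have hvelocity : rescaleLinear a (0, deriv (K.curve i) s) = (0, deriv (K.curve i) s) :=
    Prod.ext (mul_zero a) rfl
  rw [rescaledForm_apply, haxis, hvelocity, map_smul, smul_apply, smul_eq_mul, ← mul_assoc]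
  exact mul_pos (mul_self_pos.2 ha) (h i s)

end Rescale

theorem inter_fst_mem_eq_prod {S : Set Space4} (I : Set ℝ) {R : Set Space3}
    (h : ∀ q : Space4, q.1 ∈ I → (q ∈ S ↔ q.2 ∈ R)) : S ∩ {q | q.1 ∈ I} = I ×ˢ R :=
  Set.ext fun q => and_comm.trans (and_congr_right (h q))

namespace Cobordism

variable {K₀ K₁ K₂ : OrientedLink}

theorem mem_iff_of_le (W : Cobordism K₀ K₁) {q : Space4} (hq : q.1 ≤ W.T₀) :
    q ∈ W.carrier ↔ q.2 ∈ K₀.range := by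
  simpa [hq] using Set.ext_iff.1 W.lower_end q

theorem mem_iff_of_ge (W : Cobordism K₀ K₁) {q : Space4} (hq : W.T₁ ≤ q.1) :
    q ∈ W.carrier ↔ q.2 ∈ K₁.range := by
  simpa [hq] using Set.ext_iff.1 W.upper_end q

section Rescaled

variable {a b : ℝ}

theorem rescale_fst_le_iff (ha : 0 < a) {q : Space4} {T : ℝ} :
    (rescale a b ha.ne' q).1 ≤ T ↔ q.1 ≤ (T - b) / a := by
  rw [rescale_apply, le_div_iff₀' ha, le_sub_iff_add_le]

theorem le_rescale_fst_iff (ha : 0 < a) {q : Space4} {T : ℝ} :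
    T ≤ (rescale a b ha.ne' q).1 ↔ (T - b) / a ≤ q.1 := by
  rw [rescale_apply, div_le_iff₀' ha, sub_le_iff_le_add]

theorem preimage_rescale_slab (ha : 0 < a) (S : Set Space4) (T₀ T₁ : ℝ) :
    rescale a b ha.ne' ⁻¹' (S ∩ {q | T₀ ≤ q.1 ∧ q.1 ≤ T₁}) =
      rescale a b ha.ne' ⁻¹' S ∩ {q | (T₀ - b) / a ≤ q.1 ∧ q.1 ≤ (T₁ - b) / a} :=
  Set.ext fun _ => and_congr_right fun _ =>
    and_congr (le_rescale_fst_iff ha) (rescale_fst_le_iff ha)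

/-- The preimage of a cobordism under an increasing affine change of `t`. -/
noncomputable def rescaled (W : Cobordism K₀ K₁) (a b : ℝ) (ha : 0 < a) : Cobordism K₀ K₁ where
  carrier := rescale a b ha.ne' ⁻¹' W.carrier
  T₀ := (W.T₀ - b) / a
  T₁ := (W.T₁ - b) / a
  T₀_lt_T₁ := div_lt_div_of_pos_right (sub_lt_sub_right W.T₀_lt_T₁ b) ha
  isSmoothSurface := W.isSmoothSurface.preimage_rescale ha.ne'
  isCompact :=
    preimage_rescale_slab ha _ _ _ ▸ (rescale a b ha.ne').isCompact_preimage.2 W.isCompact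
  lower_end := inter_fst_mem_eq_prod (Iic _) fun _ hq =>
    W.mem_iff_of_le ((rescale_fst_le_iff ha).2 hq)
  upper_end := inter_fst_mem_eq_prod (Ici _) fun _ hq =>
    W.mem_iff_of_ge ((le_rescale_fst_iff ha).2 hq)
  orientable :=
    let ⟨Ω, hΩ, hlower, hupper⟩ := W.orientable
    ⟨rescaledForm a b ha.ne' Ω, hΩ.rescaledForm ha.ne',
      fun t ht => OrientedLink.IsPositiveAt.rescaledForm _
        (hlower _ ((rescale_fst_le_iff (q := (t, 0)) ha).2 ht)),
      fun t ht => OrientedLink.IsPositiveAt.rescaledForm _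
        (hupper _ ((le_rescale_fst_iff (q := (t, 0)) ha).2 ht))⟩

theorem HasEulerChar.rescaled {W : Cobordism K₀ K₁} {χ : ℤ} (h : W.HasEulerChar χ) (ha : 0 < a) :
    (W.rescaled a b ha).HasEulerChar χ := by
  have hA : rescale a b ha.ne' ⁻¹' W.compactPart = (W.rescaled a b ha).compactPart :=
    preimage_rescale_slab ha W.carrier W.T₀ W.T₁
  have hB : rescale a b ha.ne' ⁻¹' W.boundary = (W.rescaled a b ha).boundary := by
    ext q
    simp only [boundary, Cobordism.rescaled, mem_union, mem_prod, mem_singleton_iff, mem_preimage,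
      rescale_apply, eq_div_iff_mul_eq ha.ne', mul_comm q.1, eq_sub_iff_add_eq]
  have hpre := HasEulerCharacteristic.preimage h (rescale a b ha.ne')
  rwa [hA, hB] at hpre

end Rescaled

section Reversed

theorem reflection_fst_le_iff {q : Space4} {T : ℝ} :
    (rescale (-1) 0 (neg_ne_zero.2 one_ne_zero) q).1 ≤ T ↔ -T ≤ q.1 := by
  rw [rescale_apply, neg_one_mul, add_zero, neg_le]

theorem le_reflection_fst_iff {q : Space4} {T : ℝ} :
    T ≤ (rescale (-1) 0 (neg_ne_zero.2 one_ne_zero) q).1 ↔ q.1 ≤ -T := by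
  rw [rescale_apply, neg_one_mul, add_zero, le_neg]

theorem preimage_reflection_slab (S : Set Space4) (T₀ T₁ : ℝ) :
    rescale (-1) 0 (neg_ne_zero.2 one_ne_zero) ⁻¹' (S ∩ {q | T₀ ≤ q.1 ∧ q.1 ≤ T₁}) =
      rescale (-1) 0 (neg_ne_zero.2 one_ne_zero) ⁻¹' S ∩ {q | -T₁ ≤ q.1 ∧ q.1 ≤ -T₀} :=
  Set.ext fun _ => and_congr_right fun _ =>
    and_comm.trans (and_congr reflection_fst_le_iff le_reflection_fst_iff)

/-- The image of a cobordism under `t ↦ -t`, with the orientation that makes it a cobordism in the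
opposite direction. -/
noncomputable def reversed (W : Cobordism K₀ K₁) : Cobordism K₁ K₀ where
  carrier := rescale (-1) 0 (neg_ne_zero.2 one_ne_zero) ⁻¹' W.carrier
  T₀ := -W.T₁
  T₁ := -W.T₀
  T₀_lt_T₁ := neg_lt_neg W.T₀_lt_T₁
  isSmoothSurface := W.isSmoothSurface.preimage_rescale _
  isCompact := preimage_reflection_slab _ _ _ ▸ (rescale _ _ _).isCompact_preimage.2 W.isCompact
  lower_end := inter_fst_mem_eq_prod (Iic _) fun _ hq =>
    W.mem_iff_of_ge (le_reflection_fst_iff.2 hq)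
  upper_end := inter_fst_mem_eq_prod (Ici _) fun _ hq =>
    W.mem_iff_of_le (reflection_fst_le_iff.2 hq)
  orientable :=
    let ⟨Ω, hΩ, hlower, hupper⟩ := W.orientable
    ⟨rescaledForm (-1) 0 _ Ω, hΩ.rescaledForm _,
      fun t ht => OrientedLink.IsPositiveAt.rescaledForm _
        (hupper _ (le_reflection_fst_iff (q := (t, 0)).2 ht)),
      fun t ht => OrientedLink.IsPositiveAt.rescaledForm _
        (hlower _ (reflection_fst_le_iff (q := (t, 0)).2 ht))⟩

theorem HasEulerChar.reversed {W : Cobordism K₀ K₁} {χ : ℤ} (h : W.HasEulerChar χ) :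
    W.reversed.HasEulerChar χ := by
  have hA : rescale (-1) 0 (neg_ne_zero.2 one_ne_zero) ⁻¹' W.compactPart =
      W.reversed.compactPart := preimage_reflection_slab W.carrier W.T₀ W.T₁
  have hB : rescale (-1) 0 (neg_ne_zero.2 one_ne_zero) ⁻¹' W.boundary = W.reversed.boundary := by
    ext q
    simp only [boundary, Cobordism.reversed, mem_union, mem_prod, mem_singleton_iff, mem_preimage,
      rescale_apply, neg_one_mul, add_zero, neg_eq_iff_eq_neg, or_comm]
  have hpre := HasEulerCharacteristic.preimage h (rescale (-1) 0 (neg_ne_zero.2 one_ne_zero))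
  rwa [hA, hB] at hpre

end Reversed

section Glue

/-- The union of the lower part of `W₁` and the upper part of `W₂`, which overlap in the cylinder
`[W₁.T₁, W₂.T₀] × K₁`. -/
def gluedCarrier (W₁ : Cobordism K₀ K₁) (W₂ : Cobordism K₁ K₂) : Set Space4 :=
  {q | (q.1 ≤ W₂.T₀ ∧ q ∈ W₁.carrier) ∨ (W₁.T₁ ≤ q.1 ∧ q ∈ W₂.carrier)}

variable {W₁ : Cobordism K₀ K₁} {W₂ : Cobordism K₁ K₂}

theorem mem_gluedCarrier_left {q : Space4} (hq : q.1 ≤ W₂.T₀) :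
    q ∈ gluedCarrier W₁ W₂ ↔ q ∈ W₁.carrier :=
  ⟨fun h => h.elim And.right fun h => (W₁.mem_iff_of_ge h.1).2 ((W₂.mem_iff_of_le hq).1 h.2),
    fun h => Or.inl ⟨hq, h⟩⟩

theorem mem_gluedCarrier_right {q : Space4} (hq : W₁.T₁ ≤ q.1) :
    q ∈ gluedCarrier W₁ W₂ ↔ q ∈ W₂.carrier :=
  ⟨fun h => h.elim (fun h => (W₂.mem_iff_of_le h.1).2 ((W₁.mem_iff_of_ge hq).1 h.2)) And.right,
    fun h => Or.inr ⟨hq, h⟩⟩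

theorem gluedCarrier_inter_left {U : Set Space4} (hU : ∀ q ∈ U, q.1 ≤ W₂.T₀) :
    gluedCarrier W₁ W₂ ∩ U = W₁.carrier ∩ U :=
  Set.ext fun q => and_congr_left fun hq => mem_gluedCarrier_left (hU q hq)

theorem gluedCarrier_inter_right {U : Set Space4} (hU : ∀ q ∈ U, W₁.T₁ ≤ q.1) :
    gluedCarrier W₁ W₂ ∩ U = W₂.carrier ∩ U :=
  Set.ext fun q => and_congr_left fun hq => mem_gluedCarrier_right (hU q hq)

theorem gluedCarrier_inter_slab (h : W₁.T₁ < W₂.T₀) :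
    gluedCarrier W₁ W₂ ∩ {q | W₁.T₀ ≤ q.1 ∧ q.1 ≤ W₂.T₁} =
      W₁.compactPart ∪ W₂.compactPart ∪ Icc W₁.T₁ W₂.T₀ ×ˢ K₁.range := by
  ext q
  have hW₁ := W₁.T₀_lt_T₁
  have hW₂ := W₂.T₀_lt_T₁
  have hleft := mem_gluedCarrier_left (W₁ := W₁) (W₂ := W₂) (q := q)
  have hright := mem_gluedCarrier_right (W₁ := W₁) (W₂ := W₂) (q := q)
  have hcyl := W₁.mem_iff_of_ge (q := q)
  simp only [mem_inter_iff, mem_union, mem_ofPred_eq, compactPart, mem_prod, mem_Icc]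
  grind

theorem isSmoothSurface_gluedCarrier (h : W₁.T₁ < W₂.T₀) :
    IsSmoothSurface (gluedCarrier W₁ W₂) := by
  refine .of_locally fun p _ => ?_
  by_cases hp : p.1 < W₂.T₀
  · exact ⟨_, {q | q.1 < W₂.T₀}, W₁.isSmoothSurface, isOpen_lt continuous_fst continuous_const, hp,
      gluedCarrier_inter_left fun _ hq => le_of_lt hq⟩
  · exact ⟨_, {q | W₁.T₁ < q.1}, W₂.isSmoothSurface, isOpen_lt continuous_const continuous_fst,
      h.trans_le (not_lt.1 hp), gluedCarrier_inter_right fun _ hq => le_of_lt hq⟩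

theorem isCompact_gluedCarrier_inter_slab (h : W₁.T₁ < W₂.T₀) :
    IsCompact (gluedCarrier W₁ W₂ ∩ {q | W₁.T₀ ≤ q.1 ∧ q.1 ≤ W₂.T₁}) := by
  rw [gluedCarrier_inter_slab h]
  exact (W₁.isCompact.union W₂.isCompact).union (isCompact_Icc.prod K₁.isCompact_range)

theorem carrier_inter_overlap_left :
    W₁.carrier ∩ Ioo W₁.T₁ W₂.T₀ ×ˢ univ = Ioo W₁.T₁ W₂.T₀ ×ˢ K₁.range :=
  Set.ext fun _ => ⟨fun h => ⟨h.2.1, (W₁.mem_iff_of_ge h.2.1.1.le).1 h.1⟩,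
    fun h => ⟨(W₁.mem_iff_of_ge h.1.1.le).2 h.2, h.1, trivial⟩⟩

theorem carrier_inter_overlap_right :
    W₂.carrier ∩ Ioo W₁.T₁ W₂.T₀ ×ˢ univ = Ioo W₁.T₁ W₂.T₀ ×ˢ K₁.range :=
  Set.ext fun _ => ⟨fun h => ⟨h.2.1, (W₂.mem_iff_of_le h.2.1.2.le).1 h.1⟩,
    fun h => ⟨(W₂.mem_iff_of_le h.1.2.le).2 h.2, h.1, trivial⟩⟩

theorem isOrientationForm_overlap {Ω₁ Ω₂ : Space4 → Space4 →L[ℝ] Space4 →L[ℝ] ℝ}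
    (hΩ₁ : IsOrientationForm W₁.carrier Ω₁) (hΩ₂ : IsOrientationForm W₂.carrier Ω₂)
    (hpos₁ : ∀ t, W₁.T₁ ≤ t → K₁.IsPositiveAt Ω₁ t) (hpos₂ : ∀ t ≤ W₂.T₀, K₁.IsPositiveAt Ω₂ t)
    {φ : ℝ → ℝ} (hφ : Continuous φ) (hφmem : ∀ t, φ t ∈ Icc 0 1) :
    IsOrientationForm (Ioo W₁.T₁ W₂.T₀ ×ˢ K₁.range)
      fun q => lineMap (Ω₁ q) (Ω₂ q) (φ q.1) := by
  have hopen : IsOpen (Ioo W₁.T₁ W₂.T₀ ×ˢ (univ : Set Space3)) := isOpen_Ioo.prod isOpen_univ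
  refine .lineMap (carrier_inter_overlap_left ▸ W₁.isSmoothSurface.inter_isOpen hopen)
    (carrier_inter_overlap_left ▸ hΩ₁.inter_isOpen hopen)
    (carrier_inter_overlap_right ▸ hΩ₂.inter_isOpen hopen)
    (hφ.comp continuous_fst).continuousOn (fun q _ => hφmem q.1) ?_
  rintro ⟨t, x⟩ ⟨ht, hx⟩
  obtain ⟨i, s, rfl⟩ := mem_iUnion.1 hx
  exact ⟨(1, 0), K₁.axis_mem_tangentConeAt i s (isOpen_Ioo.mem_nhds ht),
    (0, deriv (K₁.curve i) s), K₁.velocity_mem_tangentConeAt i s ht,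
    hpos₁ t ht.1.le i s, hpos₂ t ht.2.le i s⟩

theorem exists_isOrientationForm_gluedCarrier (h : W₁.T₁ < W₂.T₀) :
    ∃ Ω, IsOrientationForm (gluedCarrier W₁ W₂) Ω ∧ (∀ t ≤ W₁.T₀, K₀.IsPositiveAt Ω t) ∧
      ∀ t, W₂.T₁ ≤ t → K₂.IsPositiveAt Ω t := by
  obtain ⟨Ω₁, hΩ₁, hlower₁, hupper₁⟩ := W₁.orientable
  obtain ⟨Ω₂, hΩ₂, hlower₂, hupper₂⟩ := W₂.orientable
  obtain ⟨c, hc, hcT⟩ := exists_between h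
  obtain ⟨d, hcd, hd⟩ := exists_between hcT
  obtain ⟨φ, hφ₀, hφ₁, hφmem⟩ := exists_continuous_zero_one_of_isClosed isClosed_Iic isClosed_Ici
    (Iic_disjoint_Ici.2 hcd.not_ge)
  have hΩ_left : ∀ q : Space4, q.1 ≤ c → lineMap (Ω₁ q) (Ω₂ q) (φ q.1) = Ω₁ q :=
    fun q hq => by rw [hφ₀ hq, Pi.zero_apply, lineMap_apply_zero]
  have hΩ_right : ∀ q : Space4, d ≤ q.1 → lineMap (Ω₁ q) (Ω₂ q) (φ q.1) = Ω₂ q :=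
    fun q hq => by rw [hφ₁ hq, Pi.one_apply, lineMap_apply_one]
  refine ⟨fun q => lineMap (Ω₁ q) (Ω₂ q) (φ q.1), .of_locally fun p _ => ?_,
    fun t ht i s => ?_, fun t ht i s => ?_⟩
  · rcases lt_or_ge p.1 c with hpc | hpc
    · exact ⟨_, Ω₁, {q | q.1 < c}, hΩ₁, isOpen_lt continuous_fst continuous_const, hpc,
        gluedCarrier_inter_left fun q hq => (hq.trans hcT).le, fun q hq => hΩ_left q (le_of_lt hq)⟩
    rcases lt_or_ge d p.1 with hpd | hpd
    · exact ⟨_, Ω₂, {q | d < q.1}, hΩ₂, isOpen_lt continuous_const continuous_fst, hpd,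
        gluedCarrier_inter_right fun q hq => ((hc.trans hcd).trans hq).le,
        fun q hq => hΩ_right q (le_of_lt hq)⟩
    · refine ⟨_, _, Ioo W₁.T₁ W₂.T₀ ×ˢ univ,
        isOrientationForm_overlap hΩ₁ hΩ₂ hupper₁ hlower₂ φ.continuous hφmem,
        isOpen_Ioo.prod isOpen_univ, ⟨⟨hc.trans_le hpc, hpd.trans_lt hd⟩, trivial⟩, ?_,
        fun _ _ => rfl⟩
      rw [gluedCarrier_inter_left fun q hq => hq.1.2.le, carrier_inter_overlap_left,
        prod_inter_prod, inter_self, inter_univ]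
  · beta_reduce
    rw [hΩ_left (t, K₀.curve i s) ((ht.trans W₁.T₀_lt_T₁.le).trans hc.le)]
    exact hlower₁ t ht i s
  · beta_reduce
    rw [hΩ_right (t, K₂.curve i s) ((hd.trans W₂.T₀_lt_T₁).le.trans ht)]
    exact hupper₂ t ht i s

/-- The composition of two cobordisms along a cylinder. -/
def glue (W₁ : Cobordism K₀ K₁) (W₂ : Cobordism K₁ K₂) (h : W₁.T₁ < W₂.T₀) : Cobordism K₀ K₂ where
  carrier := gluedCarrier W₁ W₂
  T₀ := W₁.T₀
  T₁ := W₂.T₁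
  T₀_lt_T₁ := (W₁.T₀_lt_T₁.trans h).trans W₂.T₀_lt_T₁
  isSmoothSurface := isSmoothSurface_gluedCarrier h
  isCompact := isCompact_gluedCarrier_inter_slab h
  lower_end := W₁.lower_end ▸ gluedCarrier_inter_left fun _ hq =>
    (hq.trans W₁.T₀_lt_T₁.le).trans h.le
  upper_end := W₂.upper_end ▸ gluedCarrier_inter_right fun _ hq =>
    (h.le.trans W₂.T₀_lt_T₁.le).trans hq
  orientable := exists_isOrientationForm_gluedCarrier h

theorem HasEulerChar.glue {χ₁ χ₂ : ℤ} (h₁ : W₁.HasEulerChar χ₁) (h₂ : W₂.HasEulerChar χ₂)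
    (h : W₁.T₁ < W₂.T₀) : (W₁.glue W₂ h).HasEulerChar (χ₁ + χ₂) := by
  have hdisj : ∀ {s t : ℝ} {A B : Set Space3}, s ≠ t → Disjoint ({s} ×ˢ A) ({t} ×ˢ B) :=
    fun hst => disjoint_prod.2 (Or.inl (disjoint_singleton.2 hst))
  have hW₁ := W₁.T₀_lt_T₁
  have hW₂ := W₂.T₀_lt_T₁
  have hunion := HasEulerCharacteristic.union_collar h h₁ h₂ (fun _ hq => hq.2.2)
    (fun _ hq => hq.2.1) (K₀.isClosed_slice _) (fun _ hq => hq.1.trans_lt hW₁)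
    (K₂.isClosed_slice _) (fun _ hq => hW₂.trans_eq hq.1.symm)
  rw [← gluedCarrier_inter_slab h, union_comm _ ({W₂.T₁} ×ˢ _), union_union_union_comm] at hunion
  refine hunion.of_union_left ((K₀.isClosed_slice _).union (K₂.isClosed_slice _))
    ((K₁.isClosed_slice _).union (K₁.isClosed_slice _)) ?_
  exact disjoint_union_left.2
    ⟨disjoint_union_right.2 ⟨hdisj hW₁.ne, hdisj (hW₁.trans h).ne⟩,
      disjoint_union_right.2 ⟨hdisj (h.trans hW₂).ne', hdisj hW₂.ne'⟩⟩

end Glue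

section Collared

variable (W : Cobordism K₀ K₁) {t₀ t₁ : ℝ}

theorem carrier_inter_slab (h₀ : t₀ < W.T₀) (h₁ : W.T₁ < t₁) :
    W.carrier ∩ {q | t₀ ≤ q.1 ∧ q.1 ≤ t₁} =
      W.compactPart ∪ Icc t₀ W.T₀ ×ˢ K₀.range ∪ Icc W.T₁ t₁ ×ˢ K₁.range := by
  ext q
  have hW := W.T₀_lt_T₁
  have hlower := W.mem_iff_of_le (q := q)
  have hupper := W.mem_iff_of_ge (q := q)
  simp only [mem_inter_iff, mem_union, mem_ofPred_eq, compactPart, mem_prod, mem_Icc]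
  grind

/-- A cobordism with longer cylindrical collars in its compact part. -/
def collared (t₀ t₁ : ℝ) (h₀ : t₀ < W.T₀) (h₁ : W.T₁ < t₁) : Cobordism K₀ K₁ where
  carrier := W.carrier
  T₀ := t₀
  T₁ := t₁
  T₀_lt_T₁ := (h₀.trans W.T₀_lt_T₁).trans h₁
  isSmoothSurface := W.isSmoothSurface
  isCompact := W.carrier_inter_slab h₀ h₁ ▸ (W.isCompact.union
    (isCompact_Icc.prod K₀.isCompact_range)).union (isCompact_Icc.prod K₁.isCompact_range)
  lower_end := inter_fst_mem_eq_prod (Iic _) fun _ hq => W.mem_iff_of_le (hq.trans h₀.le)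
  upper_end := inter_fst_mem_eq_prod (Ici _) fun _ hq => W.mem_iff_of_ge (h₁.le.trans hq)
  orientable :=
    let ⟨Ω, hΩ, hlower, hupper⟩ := W.orientable
    ⟨Ω, hΩ, fun t ht => hlower t (ht.trans h₀.le), fun t ht => hupper t (h₁.le.trans ht)⟩

variable {W}

theorem HasEulerChar.collared {χ : ℤ} (h : W.HasEulerChar χ) (h₀ : t₀ < W.T₀) (h₁ : W.T₁ < t₁) :
    (W.collared t₀ t₁ h₀ h₁).HasEulerChar χ := by
  have hW := W.T₀_lt_T₁
  have hlower := HasEulerCharacteristic.collar_lower h₀ h (fun _ hq => hq.2.1)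
    (K₁.isClosed_slice _) fun _ hq => hW.trans_eq hq.1.symm
  have hupper := HasEulerCharacteristic.collar_upper h₁ hlower
    (fun _ hq => hq.elim (fun hq => hq.2.2) fun hq => hq.1.2.trans hW.le)
    (K₀.isClosed_slice _) fun _ hq => hq.1.trans_lt (h₀.trans hW)
  rwa [← W.carrier_inter_slab h₀ h₁] at hupper

end Collared

end Cobordism

variable {K₀ K₁ K₂ : OrientedLink}

/-- `S` is the part over `[a, b]` of a cobordism from `K₀` to `K₁` with Euler characteristic `χ`
that is cylindrical near `t ≤ a` and near `t ≥ b`. -/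
def IsCollaredSlab (K₀ K₁ : OrientedLink) (a b : ℝ) (χ : ℤ) (S : Set Space4) : Prop :=
  ∃ W : Cobordism K₀ K₁, a < W.T₀ ∧ W.T₁ < b ∧ W.carrier ∩ {q | a ≤ q.1 ∧ q.1 ≤ b} = S ∧
    W.HasEulerChar χ

namespace IsCollaredSlab

variable {a b c : ℝ} {χ χ₁ χ₂ : ℤ} {S S₁ S₂ : Set Space4}

theorem exists_compactPart_eq (h : IsCollaredSlab K₀ K₁ a b χ S) :
    ∃ W : Cobordism K₀ K₁, W.compactPart = S ∧ W.HasEulerChar χ :=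
  let ⟨W, ha, hb, hS, hχ⟩ := h
  ⟨W.collared a b ha hb, hS, hχ.collared ha hb⟩

theorem union (h₁ : IsCollaredSlab K₀ K₁ a b χ₁ S₁) (h₂ : IsCollaredSlab K₁ K₂ b c χ₂ S₂) :
    IsCollaredSlab K₀ K₂ a c (χ₁ + χ₂) (S₁ ∪ S₂) := by
  obtain ⟨W₁, ha, hb₁, rfl, hχ₁⟩ := h₁
  obtain ⟨W₂, hb₂, hc, rfl, hχ₂⟩ := h₂
  have hb := hb₁.trans hb₂
  refine ⟨W₁.glue W₂ hb, ha, hc, Set.ext fun q => ?_, hχ₁.glue hχ₂ hb⟩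
  have hW₁ := W₁.T₀_lt_T₁
  have hW₂ := W₂.T₀_lt_T₁
  have hleft := Cobordism.mem_gluedCarrier_left (W₁ := W₁) (W₂ := W₂) (q := q)
  have hright := Cobordism.mem_gluedCarrier_right (W₁ := W₁) (W₂ := W₂) (q := q)
  simp only [Cobordism.glue, mem_inter_iff, mem_union, mem_ofPred_eq]
  grind

theorem iUnion {n : ℕ} {K : Fin (n + 2) → OrientedLink} {t : ℕ → ℝ} {e : Fin (n + 1) → ℤ}
    {S : Fin (n + 1) → Set Space4}
    (h : ∀ i : Fin (n + 1),
      IsCollaredSlab (K i.castSucc) (K i.succ) (t i) (t (i + 1)) (e i) (S i)) :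
    IsCollaredSlab (K 0) (K (Fin.last _)) (t 0) (t (n + 1)) (∑ i, e i) (⋃ i, S i) := by
  induction n with
  | zero =>
    have hS : ⋃ i, S i = S 0 := iSup_unique (ι := Fin 1) S
    rw [Fin.sum_univ_one, hS]
    exact h 0
  | succ n ih =>
    have hS : ⋃ i, S i = (⋃ i : Fin (n + 1), S i.castSucc) ∪ S (Fin.last _) := by
      ext q
      simp only [mem_iUnion, mem_union, Fin.exists_fin_succ']
    rw [Fin.sum_univ_castSucc, hS]
    exact (ih (K := fun i => K i.castSucc) fun i => h i.castSucc).union (h (Fin.last _))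

end IsCollaredSlab

namespace Cobordism.HasEulerChar

variable {W : Cobordism K₀ K₁} {χ : ℤ}

theorem isCollaredSlab_stacked (h : W.HasEulerChar χ) (k : ℕ) :
    IsCollaredSlab K₀ K₁ k (k + 1 : ℕ) χ (W.stacked k) := by
  have hlength : 0 < W.T₁ - W.T₀ + 2 := by linarith [W.T₀_lt_T₁]
  refine ⟨W.rescaled (W.T₁ - W.T₀ + 2) (W.T₀ - 1 - k * (W.T₁ - W.T₀ + 2)) hlength,
    (lt_div_iff₀ hlength).2 (by linarith), (div_lt_iff₀ hlength).2 (by push_cast; linarith), ?_,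
    h.rescaled hlength⟩
  ext q
  have hq : rescale (W.T₁ - W.T₀ + 2) (W.T₀ - 1 - k * (W.T₁ - W.T₀ + 2)) hlength.ne' q =
      (W.T₀ - 1 + (q.1 - k) * (W.T₁ - W.T₀ + 2), q.2) :=
    Prod.ext (by simp only [rescale_apply]; ring) rfl
  simp only [Cobordism.rescaled, stacked, mem_inter_iff, mem_preimage, mem_ofPred_eq, hq,
    Nat.cast_succ, and_comm, and_assoc]

theorem isCollaredSlab_stackedReversed (h : W.HasEulerChar χ) (k : ℕ) :
    IsCollaredSlab K₁ K₀ k (k + 1 : ℕ) χ (W.stackedReversed k) := by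
  have hstacked : W.reversed.stacked k = W.stackedReversed k := by
    ext q
    have hq : rescale (-1) 0 (neg_ne_zero.2 one_ne_zero)
        (-W.T₁ - 1 + (q.1 - k) * (-W.T₀ - -W.T₁ + 2), q.2) =
          (W.T₁ + 1 - (q.1 - k) * (W.T₁ - W.T₀ + 2), q.2) :=
      Prod.ext (by simp only [rescale_apply]; ring) rfl
    simp only [stacked, stackedReversed, Cobordism.reversed, mem_preimage, mem_ofPred_eq, hq]
  exact hstacked ▸ h.reversed.isCollaredSlab_stacked k

end Cobordism.HasEulerChar

variable {Λ Λ' : OrientedLink}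

theorem LagrangianBound.HasEulerChar.isCollaredSlab_composite {B : LagrangianBound Λ Λ'} {χ : ℤ}
    (h : B.HasEulerChar χ) (k : ℕ) :
    IsCollaredSlab Λ Λ' (2 * k : ℕ) (2 * (k + 1) : ℕ) χ (B.composite k) := by
  cases B with
  | upper M _ left right =>
    obtain ⟨χ₁, χ₂, hleft, hright, rfl⟩ := h
    exact (hleft.isCollaredSlab_stacked _).union (hright.isCollaredSlab_stackedReversed _)
  | lower M _ left right =>
    obtain ⟨χ₁, χ₂, hleft, hright, rfl⟩ := h
    exact (hleft.isCollaredSlab_stackedReversed _).union (hright.isCollaredSlab_stacked _)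

namespace LagrangianQuasiCobordism

variable {Q : LagrangianQuasiCobordism Λ Λ'}

theorem HasEulerChar.exists_cobordism {χ : ℤ} (h : Q.HasEulerChar χ) :
    ∃ W : Cobordism Λ Λ', W.compactPart = Q.composite ∧ W.HasEulerChar χ := by
  obtain ⟨_ | n, hn, link, rfl, rfl, bound⟩ := Q
  · exact absurd hn (lt_irrefl 0)
  obtain ⟨e, he, rfl⟩ := h
  exact (IsCollaredSlab.iUnion (K := link) (t := fun k => (2 * k : ℕ)) fun i =>
    (he i).isCollaredSlab_composite i).exists_compactPart_eq

theorem HasGenus.exists_cobordism {g : ℕ} (h : Q.HasGenus g) :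
    ∃ W : Cobordism Λ Λ', W.compactPart = Q.composite ∧ W.HasGenus g :=
  let ⟨χ, hχ, hg⟩ := h
  let ⟨W, hW, hWχ⟩ := hχ.exists_cobordism
  ⟨W, hW, χ, hWχ, hW ▸ hg⟩

end LagrangianQuasiCobordism

end LegCob

theorem lemma6p2_general (Λ Λ' : LegCob.OrientedLink) :
    LegCob.smoothCobordismGenus Λ Λ' ≤ LegCob.relativeLagrangianGenus Λ Λ' ∧
      LegCob.connectedSmoothCobordismGenus Λ Λ' ≤
        LegCob.connectedRelativeLagrangianGenus Λ Λ' := by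
  refine ⟨le_iInf fun Q => le_iInf₂ fun g hg => ?_, le_iInf fun Q => le_iInf₂ fun g hg => ?_⟩
  · obtain ⟨W, -, hWg⟩ := hg.exists_cobordism
    exact iInf_le_of_le W (iInf₂_le g hWg)
  · obtain ⟨W, hW, hWg⟩ := hg.2.exists_cobordism
    exact iInf_le_of_le W (iInf₂_le g ⟨hW ▸ hg.1, hWg⟩)

theorem lemma6p2 (Λ Λ' : LegCob.OrientedLink)
    (hΛ : Λ.IsLegendrian) (hΛ' : Λ'.IsLegendrian) (hk : Λ.IsKnot) (hk' : Λ'.IsKnot) :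
    LegCob.smoothCobordismGenus Λ Λ' ≤ LegCob.relativeLagrangianGenus Λ Λ' ∧
      LegCob.connectedSmoothCobordismGenus Λ Λ' ≤
        LegCob.connectedRelativeLagrangianGenus Λ Λ' :=
  lemma6p2_general Λ Λ'
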